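/- Let $X$ be a non-empty locally compact Hausdorff space with Borel $\sigma$-algebra $\mathscr B$, and let $C_0(X)$ be the Banach lattice of real-valued continuous functions on $X$ vanishing at infinity. All vector lattices are real. For a vector lattice $E$, a finite $E^+$-valued measure is a map $\nu:\mathscr B\to E^+$ with $\nu(\emptyset)=0$ and $\nu(\bigcup_n\Delta_n)=\sup_N\sum_{n=1}^N\nu(\Delta_n)$ for pairwise disjoint sequences $(\Delta_n)$ in $\mathscr B$. It is a regular Borel measure if $\nu(V)=\sup\{\nu(K):K\subseteq V \text{ compact}\}$ for all open $V$ and $\nu(\Delta)=\inf\{\nu(V):V\supseteq\Delta\text{ open}\}$ for all $\Delta\in\mathscr B$. Let $M_{rB}(X,\mathscr B,E)$ be the linear span, in the space of all maps from $\mathscr B$ to $E$, of the finite $E^+$-valued regular Borel measures, with the pointwise order, and let $L_r(C_0(X),E)$ be the space of regular operators (differences of positive linear operators) from $C_0(X)$ to $E$, with the operator order. For a finite $E^+$-valued measure $\nu$, put $\int_X^o\varphi\,d\nu=\sum_i r_i\nu(\Delta_i)$ for an elementary function $\varphi=\sum_i r_i\chi_{\Delta_i}\ge 0$; put $\int_X^o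 f\,d\nu=\sup_n\int_X^o\varphi_n\,d\nu$ for $f\ge 0$, where $(\varphi_n)$ is a sequence of elementary functions increasing pointwise to $f$; and put $\int_X^o f\,d\nu=\int_X^o f^+\,d\nu-\int_X^o f^-\,d\nu$ for $f\in C_0(X)$. For $\mu\in M_{rB}(X,\mathscr B,E)$, write $\mu=\nu_1-\nu_2$ with finite $E^+$-valued measures $\nu_1,\nu_2$, and put $I_\mu(f)=\int_X^o f\,d\nu_1-\int_X^o f\,d\nu_2$ for $f\in C_0(X)$. 1. Suppose that $E$ is quasi-perfect, i.e. the order bounded order continuous functionals separate the points of $E$, and every increasing net $(x_\lambda)$ in $E^+$ such that $\sup_\lambda x'(x_\lambda)<\infty$ for every positive linear functional $x'$ on $E$ has a supremum in $E$. Then $M_{rB}(X,\mathscr B,E)$ and $L_r(C_0(X),E)$ are vector lattices, $I_\mu(f)$ is well defined (the integrals exist, independently of all choices), and $\mu\mapsto I_\mu$ is a vector lattice isomorphism from $M_{rB}(X,\mathscr B,E)$ onto $L_r(C_0(X),E)$. 2. Suppose that $E$ is a KB-space, i.e. a Banach lattice in which every norm bounded increasing net in $E^+$ is norm convergent. Then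 $M_{rB}(X,\mathscr B,E)$ with the norm $\|\mu\|=\|\,|\mu|(X)\,\|$ and $L_r(C_0(X),E)$ with the regular norm $\|T\|_r=\|\,|T|\,\|$ (the operator norm of $|T|$; regular operators are bounded) are Banach lattices, and $\mu\mapsto I_\mu$ is a well-defined isometric vector lattice isomorphism from the former onto the latter. Moreover, $M_{rB}(X,\mathscr B,E)$ is an AL-space (a Banach lattice whose norm is additive on the positive cone) if and only if $E$ is, and $L_r(C_0(X),E)$ is an AL-space if and only if $E$ is. -/

import Mathlib

open Filter Topology
open scoped NNReal ZeroAtInfty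

/-! ### Partially ordered vector spaces, vector lattices and Banach lattices -/

section Order

variable {V W : Type*} [AddCommGroup V] [Module ℝ V] [PartialOrder V]
  [AddCommGroup W] [Module ℝ W] [PartialOrder W]

/-- A real vector space with a partial order is an (Archimedean) vector lattice. -/
structure IsVectorLattice (V : Type*) [AddCommGroup V] [Module ℝ V] [PartialOrder V] : Prop where
  add_le_add_right : ∀ x y z : V, x ≤ y → x + z ≤ y + z
  smul_le_smul : ∀ (r : ℝ) (x y : V), 0 ≤ r → x ≤ y → r • x ≤ r • y
  exists_sup : ∀ x y : V, ∃ s, IsLUB {x, y} s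
  exists_inf : ∀ x y : V, ∃ i, IsGLB {x, y} i
  archimedean : ∀ x y : V, 0 ≤ x → (∀ n : ℕ, n • x ≤ y) → x = 0

/-- A linear bijection is a vector lattice isomorphism: it and its inverse preserve suprema
and infima of pairs of elements. -/
structure IsVectorLatticeIso (I : V ≃ₗ[ℝ] W) : Prop where
  map_sup : ∀ x y s : V, IsLUB {x, y} s ↔ IsLUB {I x, I y} (I s)
  map_inf : ∀ x y i : V, IsGLB {x, y} i ↔ IsGLB {I x, I y} (I i)

open Classical in
/-- The modulus `|x| = x ∨ (-x)`, i.e. the supremum of `x` and `-x` (`0` if this supremum does not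
exist, which does not happen in a vector lattice). -/
noncomputable def modulus (x : V) : V :=
  if h : ∃ s, IsLUB {x, -x} s then h.choose else 0

/-- `V` is a Banach lattice in the norm `N`: a vector lattice with a complete norm such that
`|x| ≤ |y|` implies `N x ≤ N y`. -/
structure IsBanachLattice (V : Type*) [AddCommGroup V] [Module ℝ V] [PartialOrder V]
    (N : V → ℝ) : Prop where
  isVectorLattice : IsVectorLattice V
  eq_zero_of_norm : ∀ x, N x = 0 → x = 0
  norm_add_le : ∀ x y, N (x + y) ≤ N x + N y
  norm_smul : ∀ (r : ℝ) x, N (r • x) = |r| * N x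
  solid : ∀ x y, modulus x ≤ modulus y → N x ≤ N y
  complete : ∀ u : ℕ → V,
    (∀ ε > 0, ∃ n₀, ∀ m ≥ n₀, ∀ n ≥ n₀, N (u m - u n) < ε) →
      ∃ x, Tendsto (fun n => N (u n - x)) atTop (𝓝 0)

/-- `V` is an AL-space in the norm `N`: a Banach lattice whose norm is additive on the positive
cone. -/
structure IsALSpace (V : Type*) [AddCommGroup V] [Module ℝ V] [PartialOrder V]
    (N : V → ℝ) : Prop where
  isBanachLattice : IsBanachLattice V N
  norm_add : ∀ x y, 0 ≤ x → 0 ≤ y → N (x + y) = N x + N y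

end Order

/-! ### Quasi-perfect vector lattices and KB-spaces

An increasing net has the same upper bounds and limits as its range, which is an upward directed
set; a directed set is a net indexed by itself. Nets are therefore written as directed sets. -/

section Lattices

/-- The elements of the positive cone of the order dual. -/
def IsPositiveFunctional {E : Type*} [AddCommGroup E] [Module ℝ E] [PartialOrder E]
    (φ : E →ₗ[ℝ] ℝ) : Prop :=
  ∀ x, 0 ≤ x → 0 ≤ φ x

/-- The elements of the order continuous part of the order dual: `φ` maps order intervals
to bounded sets, and `φ` tends to `0` along every net that decreases to `0`. -/
structure IsOrderContinuousFunctional {E : Type*} [AddCommGroup E] [Module ℝ E] [PartialOrder E]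
    (φ : E →ₗ[ℝ] ℝ) : Prop where
  orderBounded : ∀ a b : E, Bornology.IsBounded (φ '' Set.Icc a b)
  tendsto : ∀ D : Set E, D.Nonempty → DirectedOn (· ≥ ·) D → IsGLB D 0 →
    Tendsto (fun d : D => φ d) atBot (𝓝 0)

/-- The order continuous functionals separate the points of `E`. -/
def IsNormal (E : Type*) [AddCommGroup E] [Module ℝ E] [PartialOrder E] : Prop :=
  ∀ x : E, x ≠ 0 → ∃ φ : E →ₗ[ℝ] ℝ, IsOrderContinuousFunctional φ ∧ φ x ≠ 0

/-- `E` is normal, and an increasing net in the positive cone on which every positive functional is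
bounded has a supremum. -/
structure IsQuasiPerfect (E : Type*) [AddCommGroup E] [Module ℝ E] [PartialOrder E] : Prop where
  isNormal : IsNormal E
  exists_isLUB : ∀ D : Set E, D.Nonempty → DirectedOn (· ≤ ·) D → (∀ x ∈ D, 0 ≤ x) →
    (∀ φ : E →ₗ[ℝ] ℝ, IsPositiveFunctional φ → BddAbove (φ '' D)) → ∃ s, IsLUB D s

/-- Every norm bounded increasing net in the positive cone is norm convergent. (For Banach
lattices.) -/
def IsKBSpace (E : Type*) [NormedAddCommGroup E] [PartialOrder E] : Prop :=
  ∀ D : Set E, D.Nonempty → DirectedOn (· ≤ ·) D → (∀ x ∈ D, 0 ≤ x) →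
    Bornology.IsBounded D → ∃ s, Tendsto (fun d : D => (d : E)) atTop (𝓝 s)

end Lattices

/-! ### The vector lattice `C₀(X)` -/

section ZeroAtInfty

variable {X : Type*} [TopologicalSpace X]

instance : LE C₀(X, ℝ) := ⟨fun f g => ∀ x, f x ≤ g x⟩

instance : LT C₀(X, ℝ) := ⟨fun f g => f ≤ g ∧ ¬ g ≤ f⟩

instance : Max C₀(X, ℝ) :=
  ⟨fun f g =>
    { toFun := fun x => f x ⊔ g x
      continuous_toFun := (map_continuous f).sup (map_continuous g)
      zero_at_infty' := by
        simpa using (zero_at_infty f).sup_nhds (zero_at_infty g) }⟩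

instance : Min C₀(X, ℝ) :=
  ⟨fun f g =>
    { toFun := fun x => f x ⊓ g x
      continuous_toFun := (map_continuous f).inf (map_continuous g)
      zero_at_infty' := by
        simpa using (zero_at_infty f).inf_nhds (zero_at_infty g) }⟩

/-- The pointwise lattice structure. -/
instance : Lattice C₀(X, ℝ) :=
  Function.Injective.lattice (fun f : C₀(X, ℝ) => (f : X → ℝ)) DFunLike.coe_injective
    Iff.rfl (by intro f g; exact lt_iff_le_not_ge) (fun _ _ => rfl) (fun _ _ => rfl)

instance : IsOrderedAddMonoid C₀(X, ℝ) where
  add_le_add_left _ _ h k x := by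
    simpa using h x

end ZeroAtInfty

/-! ### Regular operators -/

section Regular

variable {F E : Type*}
  [AddCommGroup F] [Module ℝ F] [Lattice F] [IsOrderedAddMonoid F]
  [AddCommGroup E] [Module ℝ E] [Lattice E] [IsOrderedAddMonoid E] [IsOrderedModule ℝ E]

/-- A linear operator that maps the positive cone into the positive cone. -/
def IsPositiveOperator (T : F →ₗ[ℝ] E) : Prop := ∀ x, 0 ≤ x → 0 ≤ T x

variable (F E) in
/-- The regular operators from `F` to `E`, i.e. the differences of two positive operators. -/
def RegularOperators : Submodule ℝ (F →ₗ[ℝ] E) where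
  carrier := {T | ∃ S R : F →ₗ[ℝ] E, IsPositiveOperator S ∧ IsPositiveOperator R ∧ T = S - R}
  zero_mem' := ⟨0, 0, fun _ _ => le_rfl, fun _ _ => le_rfl, by simp⟩
  add_mem' := by
    rintro _ _ ⟨S, R, hS, hR, rfl⟩ ⟨S', R', hS', hR', rfl⟩
    exact ⟨S + S', R + R', fun x hx => add_nonneg (hS x hx) (hS' x hx),
      fun x hx => add_nonneg (hR x hx) (hR' x hx), by abel⟩
  smul_mem' := by
    rintro c _ ⟨S, R, hS, hR, rfl⟩
    rcases le_total 0 c with hc | hc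
    · exact ⟨c • S, c • R, fun x hx => smul_nonneg hc (hS x hx),
        fun x hx => smul_nonneg hc (hR x hx), smul_sub _ _ _⟩
    · exact ⟨(-c) • R, (-c) • S, fun x hx => smul_nonneg (neg_nonneg.2 hc) (hR x hx),
        fun x hx => smul_nonneg (neg_nonneg.2 hc) (hS x hx), by
          simp only [neg_smul, smul_sub]; abel⟩

/-- The operator order: `S ≤ T` when `T - S` is a positive operator. -/
instance RegularOperators.instPartialOrder : PartialOrder (RegularOperators F E) where
  le S T := ∀ x, 0 ≤ x → S.1 x ≤ T.1 x
  le_refl _ _ _ := le_rfl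
  le_trans _ _ _ h k x hx := (h x hx).trans (k x hx)
  le_antisymm S T h k := by
    apply Subtype.ext
    ext x
    have e : ∀ y, 0 ≤ y → S.1 y = T.1 y := fun y hy => le_antisymm (h y hy) (k y hy)
    rw [← posPart_sub_negPart x, map_sub, map_sub, e _ (posPart_nonneg x),
      e _ (negPart_nonneg x)]

end Regular

/-- The regular norm `‖T‖ᵣ = ‖|T|‖`, the operator norm of the modulus of `T`. -/
noncomputable def regularNorm {F E : Type*}
    [NormedAddCommGroup F] [NormedSpace ℝ F] [Lattice F] [IsOrderedAddMonoid F]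
    [NormedAddCommGroup E] [NormedSpace ℝ E] [Lattice E] [IsOrderedAddMonoid E]
    [IsOrderedModule ℝ E] (T : RegularOperators F E) : ℝ :=
  sSup {c | ∃ x : F, ‖x‖ ≤ 1 ∧ c = ‖(modulus T).1 x‖}

/-! ### Measures with values in a vector lattice -/

section Measures

variable {X : Type*} [MeasurableSpace X]
  {E : Type*} [AddCommGroup E] [Module ℝ E] [PartialOrder E]

/-- A (finite) measure with values in the positive cone of `E`: the value at `∅` is `0`, and the
value at a disjoint union is the supremum of the partial sums. -/
structure IsPositiveMeasure (ν : {s : Set X // MeasurableSet s} → E) : Prop where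
  nonneg : ∀ s, 0 ≤ ν s
  empty : ν ⟨∅, MeasurableSet.empty⟩ = 0
  iUnion : ∀ (A : ℕ → Set X) (hA : ∀ n, MeasurableSet (A n)),
    Pairwise (fun m n => Disjoint (A m) (A n)) →
      IsLUB (Set.range fun N : ℕ => ∑ n ∈ Finset.range (N + 1), ν ⟨A n, hA n⟩)
        (ν ⟨⋃ n, A n, MeasurableSet.iUnion hA⟩)

/-- A finite regular Borel measure with values in the positive cone of `E`: inner regular at all
open sets and outer regular at all Borel sets. -/
structure IsPositiveRegularBorelMeasure [TopologicalSpace X] [T2Space X] [BorelSpace X]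
    (ν : {s : Set X // MeasurableSet s} → E) : Prop extends IsPositiveMeasure ν where
  innerRegular : ∀ (V : Set X) (hV : IsOpen V),
    IsLUB {a | ∃ (K : Set X) (hK : IsCompact K), K ⊆ V ∧ a = ν ⟨K, hK.measurableSet⟩}
      (ν ⟨V, hV.measurableSet⟩)
  outerRegular : ∀ (A : Set X) (hA : MeasurableSet A),
    IsGLB {a | ∃ (V : Set X) (hV : IsOpen V), A ⊆ V ∧ a = ν ⟨V, hV.measurableSet⟩}
      (ν ⟨A, hA⟩)

variable (X E) in
/-- The `E`-valued regular Borel measures on `X`: the linear span, in the space of all set maps from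
the Borel σ-algebra to `E`, of the finite regular Borel measures with values in the positive cone.
Its order is the pointwise one. -/
def RegularBorelMeasures [TopologicalSpace X] [T2Space X] [BorelSpace X] :
    Submodule ℝ ({s : Set X // MeasurableSet s} → E) :=
  Submodule.span ℝ {ν | IsPositiveRegularBorelMeasure ν}

/-- The integral `∑ r • ν (φ = r)` of an elementary function `φ`. -/
noncomputable def elementaryIntegral (ν : {s : Set X // MeasurableSet s} → E)
    (φ : MeasureTheory.SimpleFunc X ℝ≥0) : E :=
  ∑ r ∈ φ.range, (r : ℝ) • ν ⟨φ ⁻¹' {r}, φ.measurableSet_fiber r⟩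

/-- `a` is the order integral of `f : X → [0, ∞)` with respect to the positive measure `ν`: the
supremum of the integrals of a sequence of elementary functions that increases to `f`. -/
def HasPositiveOrderIntegral (ν : {s : Set X // MeasurableSet s} → E) (f : X → ℝ) (a : E) : Prop :=
  ∃ φ : ℕ → MeasureTheory.SimpleFunc X ℝ≥0,
    (∀ x, Monotone fun n => φ n x) ∧
    (∀ x, Tendsto (fun n => (φ n x : ℝ)) atTop (𝓝 (f x))) ∧
    IsLUB (Set.range fun n => elementaryIntegral ν (φ n)) a

/-- `a` is the order integral of `f : X → ℝ` with respect to the positive measure `ν`: the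
difference of the order integrals of the positive and the negative part of `f`. -/
def HasOrderIntegral (ν : {s : Set X // MeasurableSet s} → E) (f : X → ℝ) (a : E) : Prop :=
  ∃ b c : E, HasPositiveOrderIntegral ν (fun x => max (f x) 0) b ∧
    HasPositiveOrderIntegral ν (fun x => max (-f x) 0) c ∧ a = b - c

/-- `a` is the order integral of `f : X → ℝ` with respect to the `E`-valued measure `μ`: the
difference of the order integrals with respect to `ν₁` and `ν₂`, where `μ = ν₁ - ν₂` with `ν₁, ν₂`
measures with values in the positive cone. -/
def HasSignedOrderIntegral (μ : {s : Set X // MeasurableSet s} → E) (f : X → ℝ) (a : E) : Prop :=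
  ∃ ν₁ ν₂ : {s : Set X // MeasurableSet s} → E,
    IsPositiveMeasure ν₁ ∧ IsPositiveMeasure ν₂ ∧ μ = ν₁ - ν₂ ∧
      ∃ a₁ a₂ : E, HasOrderIntegral ν₁ f a₁ ∧ HasOrderIntegral ν₂ f a₂ ∧ a = a₁ - a₂

end Measures

/-- The norm `‖μ‖ = ‖|μ|(X)‖` of an `E`-valued regular Borel measure. -/
noncomputable def measureNorm {X : Type*} [TopologicalSpace X] [T2Space X] [MeasurableSpace X]
    [BorelSpace X] {E : Type*} [NormedAddCommGroup E] [NormedSpace ℝ E] [PartialOrder E]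
    (μ : RegularBorelMeasures X E) : ℝ :=
  ‖(modulus μ).1 ⟨Set.univ, MeasurableSet.univ⟩‖

/-- The linear bijection `I` is the integration map: for all `μ` and `f`, the order integral of `f`
with respect to `μ` exists, does not depend on the choices in its definition, and equals `I μ f`. -/
def IsIntegrationMap {X : Type*} [TopologicalSpace X] [T2Space X] [MeasurableSpace X] [BorelSpace X]
    {E : Type*} [AddCommGroup E] [Module ℝ E] [Lattice E] [IsOrderedAddMonoid E]
    [IsOrderedModule ℝ E]
    (I : RegularBorelMeasures X E ≃ₗ[ℝ] RegularOperators C₀(X, ℝ) E) : Prop :=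
  ∀ (μ : RegularBorelMeasures X E) (f : C₀(X, ℝ)) (a : E),
    HasSignedOrderIntegral μ.1 f a ↔ a = (I μ).1 f

/-! The theorem reduces to the scalar Riesz representation theorem by composing with normal
functionals, i.e. positive functionals on `E` that preserve directed suprema. A quasi-perfect
lattice is Dedekind complete (`IsQuasiPerfect.isDedekindComplete`), and the positive part of an
order continuous functional is normal, so normal functionals separate the points
(`IsQuasiPerfect.normalSeparating`). Identities in `E` can then be checked under every normal `φ`,
and an upper bound of a directed set is its supremum as soon as this holds for all the images.

For a positive vector measure `ν`, each `φ ∘ ν` is a finite scalar measure, regular if `ν` is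
(`IsPositiveRegularBorelMeasure.regular_scalar`, with converse
`IsPositiveRegularBorelMeasure.of_scalar`). By monotone convergence `φ` maps an order integral to a
Lebesgue integral, so order integrals do not depend on the approximating sequence, and the signed
integral does not depend on the decomposition of the measure.

To represent a positive operator `S`, let `a V` be the supremum of `S f` over `0 ≤ f ≤ 1` vanishing
off the open set `V`, and let `ν A` be the infimum of `a V` over open `V ⊇ A`. If `m φ` is the
scalar measure representing `φ ∘ S`, then `φ (a V) = m φ V` and hence `φ (ν A) = m φ A`, which makes
`ν` a regular measure (`exists_positive_measure_of_isPositiveOperator`). Uniqueness of regular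
representing measures gives injectivity. The resulting linear bijection preserves and reflects
order; the operators form a lattice by the Riesz-Kantorovich formula, and the measures inherit this
structure.

A KB-space is quasi-perfect by Hahn-Banach and Banach-Steinhaus. There `|μ|(X)` is the norm limit,
not just the supremum, of the integrals of `0 ≤ f ≤ 1` against `|μ|`, which gives the isometry. For
the AL property, evaluation at `X` is additive in one direction, and the operators `f ↦ f(p) x`
embed the positive cone of `E` isometrically in the other. -/

/-! ### Riesz-Kantorovich formula and normal functionals -/

section OrderTheory

open scoped Pointwise

set_option linter.unusedSectionVars false

/-- Every non-empty set that is bounded above has a supremum. -/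
def IsDedekindComplete (E : Type*) [PartialOrder E] : Prop :=
  ∀ A : Set E, A.Nonempty → BddAbove A → ∃ s, IsLUB A s

variable {F E : Type*}
  [AddCommGroup F] [Module ℝ F] [Lattice F] [IsOrderedAddMonoid F] [IsOrderedModule ℝ F]
  [AddCommGroup E] [Module ℝ E] [Lattice E] [IsOrderedAddMonoid E] [IsOrderedModule ℝ E]

/-- An additive positively homogeneous map on the positive cone extends to a linear map. -/
theorem exists_linearMap_of_cone (p : F → E)
    (hadd : ∀ u v, 0 ≤ u → 0 ≤ v → p (u + v) = p u + p v)
    (hsmul : ∀ (c : ℝ) u, 0 ≤ c → 0 ≤ u → p (c • u) = c • p u) :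
    ∃ P : F →ₗ[ℝ] E, ∀ u, 0 ≤ u → P u = p u := by
  -- The difference of values is the same for every decomposition of an element into positive
  -- elements, so the extension by positive and negative parts is additive.
  have key : ∀ u v, 0 ≤ u → 0 ≤ v → p (u - v)⁺ - p (u - v)⁻ = p u - p v := by
    intro u v hu hv
    have h : (u - v)⁺ + v = u + (u - v)⁻ := by
      have := posPart_sub_negPart (u - v)
      rw [sub_eq_sub_iff_add_eq_add] at this
      exact this
    have h2 := congrArg p h
    rw [hadd _ _ (posPart_nonneg _) hv, hadd _ _ hu (negPart_nonneg _)] at h2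
    rw [sub_eq_sub_iff_add_eq_add, h2]
  refine ⟨{ toFun := fun f => p f⁺ - p f⁻, map_add' := ?_, map_smul' := ?_ }, ?_⟩
  · intro f g
    have h : f + g = (f⁺ + g⁺) - (f⁻ + g⁻) := by
      conv_lhs => rw [← posPart_sub_negPart f, ← posPart_sub_negPart g]
      abel
    rw [h, key _ _ (add_nonneg (posPart_nonneg _) (posPart_nonneg _))
      (add_nonneg (negPart_nonneg _) (negPart_nonneg _)),
      hadd _ _ (posPart_nonneg _) (posPart_nonneg _),
      hadd _ _ (negPart_nonneg _) (negPart_nonneg _)]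
    abel
  · intro c f
    rcases le_total 0 c with hc | hc
    · have h : c • f = c • f⁺ - c • f⁻ := by rw [← smul_sub, posPart_sub_negPart]
      rw [h, key _ _ (smul_nonneg hc (posPart_nonneg _)) (smul_nonneg hc (negPart_nonneg _)),
        hsmul _ _ hc (posPart_nonneg _), hsmul _ _ hc (negPart_nonneg _), ← smul_sub]
      rfl
    · have hc' : 0 ≤ -c := neg_nonneg.2 hc
      have h : c • f = (-c) • f⁻ - (-c) • f⁺ := by
        rw [← smul_sub, ← neg_sub f⁺, posPart_sub_negPart, smul_neg, neg_smul, neg_neg]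
      rw [h, key _ _ (smul_nonneg hc' (negPart_nonneg _)) (smul_nonneg hc' (posPart_nonneg _)),
        hsmul _ _ hc' (posPart_nonneg _), hsmul _ _ hc' (negPart_nonneg _), ← smul_sub]
      simp only [RingHom.id_apply, neg_smul, smul_sub]
      abel
  · intro u hu
    have h0 : p 0 = 0 := by simpa using hsmul 0 0 le_rfl le_rfl
    simp [posPart_of_nonneg hu, negPart_of_nonneg hu, h0]

/-- The Riesz decomposition of an order interval. -/
theorem image_Icc_add (T : F →ₗ[ℝ] E) {u v : F} (hu : 0 ≤ u) (hv : 0 ≤ v) :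
    T '' Set.Icc 0 (u + v) = T '' Set.Icc 0 u + T '' Set.Icc 0 v := by
  ext y
  constructor
  · rintro ⟨g, ⟨hg0, hg⟩, rfl⟩
    refine ⟨T (g ⊓ u), ⟨_, ⟨le_inf hg0 hu, inf_le_right⟩, rfl⟩, T (g - g ⊓ u),
      ⟨_, ⟨sub_nonneg.2 inf_le_left, ?_⟩, rfl⟩, by simp⟩
    rw [sub_le_comm]
    exact le_inf (sub_le_self _ hv) (sub_le_iff_le_add.2 hg)
  · rintro ⟨_, ⟨a, ⟨ha0, ha⟩, rfl⟩, _, ⟨b, ⟨hb0, hb⟩, rfl⟩, rfl⟩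
    exact ⟨a + b, ⟨add_nonneg ha0 hb0, add_le_add ha hb⟩, map_add _ _ _⟩

/-- The Riesz-Kantorovich formula. -/
theorem exists_posPart_operator (hE : IsDedekindComplete E) (T : F →ₗ[ℝ] E)
    (hT : ∀ u, 0 ≤ u → BddAbove (T '' Set.Icc 0 u)) :
    ∃ P : F →ₗ[ℝ] E, ∀ u, 0 ≤ u → IsLUB (T '' Set.Icc 0 u) (P u) := by
  have h : ∀ u : F, ∃ s, 0 ≤ u → IsLUB (T '' Set.Icc 0 u) s := by
    intro u
    by_cases hu : 0 ≤ u
    · obtain ⟨s, hs⟩ := hE (T '' Set.Icc 0 u) ⟨T 0, 0, ⟨le_rfl, hu⟩, rfl⟩ (hT u hu)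
      exact ⟨s, fun _ => hs⟩
    · exact ⟨0, fun h => absurd h hu⟩
  choose p hp using h
  -- Additivity on the cone: by Riesz decomposition the image of the interval for `u + v` is a
  -- Minkowski sum, and suprema add.
  obtain ⟨P, hP⟩ := exists_linearMap_of_cone p (fun u v hu hv => by
      have h1 := hp _ (add_nonneg hu hv)
      rw [image_Icc_add T hu hv] at h1
      exact h1.unique ((hp u hu).add (hp v hv))) (fun c u hc hu => by
      rcases hc.eq_or_lt with rfl | hc
      · rw [zero_smul, zero_smul]
        have := hp 0 le_rfl
        simpa using this.unique (by simp)
      · refine (hp _ (smul_nonneg hc.le hu)).unique ⟨?_, ?_⟩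
        · rintro _ ⟨g, ⟨hg0, hg⟩, rfl⟩
          have h1 : T (c⁻¹ • g) ≤ p u := (hp u hu).1 ⟨_, ⟨smul_nonneg (inv_nonneg.2 hc.le) hg0, by
            have := smul_le_smul_of_nonneg_left hg (inv_nonneg.2 hc.le)
            rwa [inv_smul_smul₀ hc.ne'] at this⟩, rfl⟩
          have h2 := smul_le_smul_of_nonneg_left h1 hc.le
          rwa [map_smul, smul_inv_smul₀ hc.ne'] at h2
        · intro b hb
          have h1 : p u ≤ c⁻¹ • b := (hp u hu).2 (by
            rintro _ ⟨g, ⟨hg0, hg⟩, rfl⟩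
            have h2 : T (c • g) ≤ b := hb ⟨_, ⟨smul_nonneg hc.le hg0,
              smul_le_smul_of_nonneg_left hg hc.le⟩, rfl⟩
            have := smul_le_smul_of_nonneg_left h2 (inv_nonneg.2 hc.le)
            rwa [map_smul, inv_smul_smul₀ hc.ne'] at this)
          have h2 := smul_le_smul_of_nonneg_left h1 hc.le
          rwa [smul_inv_smul₀ hc.ne'] at h2)
  exact ⟨P, fun u hu => by rw [hP u hu]; exact hp u hu⟩

/-- A positive functional that preserves suprema of directed sets. -/
structure IsNormalFunctional (φ : E →ₗ[ℝ] ℝ) : Prop where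
  pos : IsPositiveFunctional φ
  isLUB : ∀ (D : Set E) (s : E), D.Nonempty → DirectedOn (· ≤ ·) D → IsLUB D s →
    IsLUB (φ '' D) (φ s)

variable (E) in
/-- Normal functionals separate the points. -/
def NormalSeparating : Prop := ∀ x : E, (∀ φ : E →ₗ[ℝ] ℝ, IsNormalFunctional φ → φ x = 0) → x = 0

theorem NormalSeparating.ext (hS : NormalSeparating E) {x y : E}
    (h : ∀ φ : E →ₗ[ℝ] ℝ, IsNormalFunctional φ → φ x = φ y) : x = y :=
  sub_eq_zero.1 (hS _ fun φ hφ => by rw [map_sub, h φ hφ, sub_self])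

theorem IsPositiveFunctional.mono {φ : E →ₗ[ℝ] ℝ} (h : IsPositiveFunctional φ) {x y : E}
    (hxy : x ≤ y) : φ x ≤ φ y := by
  have := h _ (sub_nonneg.2 hxy)
  rw [map_sub] at this
  linarith

theorem IsNormalFunctional.isGLB {φ : E →ₗ[ℝ] ℝ} (hφ : IsNormalFunctional φ) {D : Set E} {s : E}
    (hne : D.Nonempty) (hD : DirectedOn (· ≥ ·) D) (hs : IsGLB D s) : IsGLB (φ '' D) (φ s) := by
  have h := hφ.isLUB (-D) (-s) hne.neg (by
    intro x hx y hy
    obtain ⟨z, hz, h1, h2⟩ := hD _ hx _ hy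
    exact ⟨-z, by simpa using hz, le_neg.1 h1, le_neg.1 h2⟩) hs.neg
  have h2 : φ '' (-D) = -(φ '' D) := by
    ext y
    constructor
    · rintro ⟨x, hx, rfl⟩
      exact ⟨-x, hx, map_neg _ _⟩
    · rintro ⟨x, hx, hxy⟩
      exact ⟨-x, by simpa using hx, by rw [map_neg, hxy, neg_neg]⟩
  rw [h2, map_neg, isLUB_neg] at h
  simpa using h

/-- Dedekind completeness supplies some supremum of `D`; every normal functional takes the same
value on it and on `a`, so the two coincide. -/
theorem NormalSeparating.isLUB_of_scalar (hE : IsDedekindComplete E) (hS : NormalSeparating E)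
    {D : Set E} {a : E} (hne : D.Nonempty) (hD : DirectedOn (· ≤ ·) D) (ha : a ∈ upperBounds D)
    (h : ∀ φ : E →ₗ[ℝ] ℝ, IsNormalFunctional φ → IsLUB (φ '' D) (φ a)) : IsLUB D a := by
  obtain ⟨s, hs⟩ := hE D hne ⟨a, ha⟩
  have : s = a := hS.ext fun φ hφ => (hφ.isLUB D s hne hD hs).unique (h φ hφ)
  rwa [← this]

theorem IsDedekindComplete.exists_isGLB (hE : IsDedekindComplete E) {A : Set E} (hA : A.Nonempty)
    (hb : BddBelow A) : ∃ s, IsGLB A s := by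
  obtain ⟨s, hs⟩ := hE (-A) hA.neg hb.neg
  exact ⟨-s, by simpa using hs.neg⟩

theorem NormalSeparating.isGLB_of_scalar (hE : IsDedekindComplete E) (hS : NormalSeparating E)
    {D : Set E} {a : E} (hne : D.Nonempty) (hD : DirectedOn (· ≥ ·) D) (ha : a ∈ lowerBounds D)
    (h : ∀ φ : E →ₗ[ℝ] ℝ, IsNormalFunctional φ → IsGLB (φ '' D) (φ a)) : IsGLB D a := by
  obtain ⟨s, hs⟩ := hE.exists_isGLB hne ⟨a, ha⟩
  have : s = a := hS.ext fun φ hφ => (hφ.isGLB hne hD hs).unique (h φ hφ)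
  rwa [← this]

/-- Closing `A` under finite suprema makes it directed with the same upper bounds. Joining with `a₀`
and subtracting it moves the set into the positive cone, where a positive `φ` is bounded by `φ (b -
a₀)`. -/
theorem IsQuasiPerfect.isDedekindComplete (hE : IsQuasiPerfect E) : IsDedekindComplete E := by
  rintro A ⟨a₀, ha₀⟩ ⟨b, hb⟩
  have hb' : b ∈ upperBounds (supClosure A) := by rwa [upperBounds_supClosure]
  obtain ⟨s, hs⟩ := hE.exists_isLUB ((fun x => x ⊔ a₀ - a₀) '' supClosure A)
    ⟨_, a₀, subset_supClosure ha₀, rfl⟩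
    (by
      rintro _ ⟨x, hx, rfl⟩ _ ⟨y, hy, rfl⟩
      exact ⟨_, ⟨x ⊔ y, supClosed_supClosure hx hy, rfl⟩,
        sub_le_sub_right (sup_le_sup_right le_sup_left _) _,
        sub_le_sub_right (sup_le_sup_right le_sup_right _) _⟩)
    (by rintro _ ⟨x, hx, rfl⟩; exact sub_nonneg.2 le_sup_right)
    (fun φ hφ => ⟨φ (b - a₀), by
      rintro _ ⟨_, ⟨x, hx, rfl⟩, rfl⟩
      exact hφ.mono (sub_le_sub_right (sup_le (hb' hx) (hb ha₀)) _)⟩)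
  refine ⟨s + a₀, fun x hx => ?_, fun c hc => ?_⟩
  · have := hs.1 ⟨x, subset_supClosure hx, rfl⟩
    exact le_sup_left.trans (sub_le_iff_le_add.1 this)
  · rw [← le_sub_iff_add_le]
    refine hs.2 ?_
    rintro _ ⟨x, hx, rfl⟩
    have hc' : c ∈ upperBounds (supClosure A) := by rwa [upperBounds_supClosure]
    exact sub_le_sub_right (sup_le (hc' hx) (hc ha₀)) _

theorem isDedekindComplete_real : IsDedekindComplete ℝ :=
  fun _ h hb => ⟨_, isLUB_csSup h hb⟩

theorem sub_inf_le_sub {y d e : E} (hy : y ≤ e) (hd : d ≤ e) : y - y ⊓ d ≤ e - d := by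
  rw [sub_le_comm]
  refine le_inf (sub_le_self _ (sub_nonneg.2 hd)) ?_
  rw [sub_le_iff_le_add, add_sub_cancel]
  exact hy

/-- The positive part of an order continuous functional is normal. -/
theorem IsOrderContinuousFunctional.isNormalFunctional {φ ψ : E →ₗ[ℝ] ℝ}
    (hφ : IsOrderContinuousFunctional φ)
    (hψ : ∀ u, 0 ≤ u → IsLUB (φ '' Set.Icc 0 u) (ψ u)) : IsNormalFunctional ψ := by
  have hpos : IsPositiveFunctional ψ := fun u hu =>
    (hψ u hu).1 ⟨0, ⟨le_rfl, hu⟩, map_zero _⟩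
  have hle : ∀ u v, 0 ≤ v → v ≤ u → φ v ≤ ψ u := fun u v hv hvu =>
    (hψ u (hv.trans hvu)).1 ⟨v, ⟨hv, hvu⟩, rfl⟩
  have key : ∀ D : Set E, D.Nonempty → DirectedOn (· ≥ ·) D → IsGLB D 0 →
      ∀ ε > 0, ∃ d ∈ D, ψ d < ε := by
    intro D hne hD h0 ε hε
    obtain ⟨e, he⟩ := hne
    have he0 : 0 ≤ e := h0.1 he
    -- With `φ y` within `ε / 2` of `ψ e`, the elements `y ⊓ d` decrease to `0`, so `φ (y ⊓ d) < ε /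
    -- 2` for small `d`. Since `y - y ⊓ d` lies between `0` and `e - d`, `ψ d ≤ ψ e - φ y + φ (y ⊓
    -- d) < ε`.
    obtain ⟨_, ⟨y, ⟨hy0, hye⟩, rfl⟩, hy, -⟩ :=
      (hψ e he0).exists_between (sub_lt_self (ψ e) (half_pos hε))
    set D' : Set E := (fun d => y ⊓ d) '' D with hD'
    have hne' : D'.Nonempty := ⟨_, e, he, rfl⟩
    have hdir' : DirectedOn (· ≥ ·) D' := by
      rintro _ ⟨a, ha, rfl⟩ _ ⟨b, hb, rfl⟩
      obtain ⟨c, hc, h1, h2⟩ := hD a ha b hb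
      exact ⟨_, ⟨c, hc, rfl⟩, inf_le_inf_left _ h1, inf_le_inf_left _ h2⟩
    have hglb' : IsGLB D' 0 := by
      refine ⟨?_, fun b hb => h0.2 fun d hd => (hb ⟨d, hd, rfl⟩).trans inf_le_right⟩
      rintro _ ⟨d, hd, rfl⟩
      exact le_inf hy0 (h0.1 hd)
    have ht := hφ.tendsto D' hne' hdir' hglb'
    have : Nonempty D' := hne'.to_subtype
    have : IsCodirectedOrder D' := ⟨fun a b => by
      obtain ⟨c, hc, h1, h2⟩ := hdir' a a.2 b b.2
      exact ⟨⟨c, hc⟩, h1, h2⟩⟩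
    have hev := ht.eventually (gt_mem_nhds (half_pos hε))
    obtain ⟨⟨_, ⟨d₀, hd₀, rfl⟩⟩, hd⟩ := hev.exists_forall_of_atBot
    obtain ⟨d, hdD, h1, h2⟩ := hD d₀ hd₀ e he
    refine ⟨d, hdD, ?_⟩
    have h3 : φ (y ⊓ d) < ε / 2 := hd ⟨_, ⟨d, hdD, rfl⟩⟩ (inf_le_inf_left _ h1)
    have h4 : φ (y - y ⊓ d) ≤ ψ (e - d) :=
      hle _ _ (sub_nonneg.2 inf_le_left) (sub_inf_le_sub hye h2)
    rw [map_sub, map_sub] at h4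
    linarith
  refine ⟨hpos, fun D s hne hD hs => ⟨?_, fun b hb => ?_⟩⟩
  · rintro _ ⟨d, hd, rfl⟩
    exact hpos.mono (hs.1 hd)
  · refine le_of_forall_pos_le_add fun ε hε => ?_
    obtain ⟨_, ⟨d, hd, rfl⟩, hlt⟩ := key ((fun d => s - d) '' D) (hne.image _) (by
        rintro _ ⟨a, ha, rfl⟩ _ ⟨b, hb, rfl⟩
        obtain ⟨c, hc, h1, h2⟩ := hD a ha b hb
        exact ⟨_, ⟨c, hc, rfl⟩, sub_le_sub_left h1 _, sub_le_sub_left h2 _⟩) (by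
        refine ⟨?_, fun b hb => ?_⟩
        · rintro _ ⟨d, hd, rfl⟩
          exact sub_nonneg.2 (hs.1 hd)
        · have : s ≤ s - b := hs.2 fun d hd => le_sub_comm.1 (hb ⟨d, hd, rfl⟩)
          simpa using this) ε hε
    have h1 : ψ d ≤ b := hb ⟨d, hd, rfl⟩
    rw [map_sub] at hlt
    linarith

theorem IsOrderContinuousFunctional.neg {φ : E →ₗ[ℝ] ℝ}
    (hφ : IsOrderContinuousFunctional φ) : IsOrderContinuousFunctional (-φ) := by
  refine ⟨fun a b => ?_, fun D h1 h2 h3 => by simpa using (hφ.tendsto D h1 h2 h3).neg⟩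
  have : (-φ) '' Set.Icc a b = -(φ '' Set.Icc a b) := by
    rw [← Set.image_neg_eq_neg, Set.image_image]; rfl
  rw [this]
  exact (hφ.orderBounded a b).neg

/-- An order continuous functional is the difference of its positive and negative parts, and both
are normal. If all normal functionals vanish at `x`, so do all order continuous ones. -/
theorem IsQuasiPerfect.normalSeparating (hE : IsQuasiPerfect E) : NormalSeparating E := by
  intro x hx
  by_contra hne
  obtain ⟨φ, hφ, hφx⟩ := hE.isNormal x hne
  have hex : ∀ φ : E →ₗ[ℝ] ℝ, IsOrderContinuousFunctional φ →
      ∃ P : E →ₗ[ℝ] ℝ, ∀ u, 0 ≤ u → IsLUB (φ '' Set.Icc 0 u) (P u) := fun φ hφ =>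
    exists_posPart_operator isDedekindComplete_real φ fun u _ => (hφ.orderBounded 0 u).bddAbove
  obtain ⟨P, hP⟩ := hex φ hφ
  obtain ⟨Q, hQ⟩ := hex (-φ) hφ.neg
  have hP0 := hx P (hφ.isNormalFunctional hP)
  have hQ0 := hx Q (hφ.neg.isNormalFunctional hQ)
  have key : ∀ u, 0 ≤ u → φ u = P u - Q u := by
    intro u hu
    have h1 : P u ≤ φ u + Q u := (hP u hu).2 (by
      rintro _ ⟨v, ⟨hv0, hv⟩, rfl⟩
      have : (-φ) (u - v) ≤ Q u := (hQ u hu).1 ⟨_, ⟨sub_nonneg.2 hv, sub_le_self _ hv0⟩, rfl⟩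
      simp only [LinearMap.neg_apply, map_sub] at this
      linarith)
    have h2 : Q u ≤ P u - φ u := (hQ u hu).2 (by
      rintro _ ⟨v, ⟨hv0, hv⟩, rfl⟩
      have : φ (u - v) ≤ P u := (hP u hu).1 ⟨_, ⟨sub_nonneg.2 hv, sub_le_self _ hv0⟩, rfl⟩
      simp only [LinearMap.neg_apply, map_sub] at this ⊢
      linarith)
    linarith
  apply hφx
  rw [← posPart_sub_negPart x, map_sub, key _ (posPart_nonneg _), key _ (negPart_nonneg _)]
  have e1 : P x = P x⁺ - P x⁻ := by rw [← map_sub, posPart_sub_negPart]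
  have e2 : Q x = Q x⁺ - Q x⁻ := by rw [← map_sub, posPart_sub_negPart]
  linarith

end OrderTheory

/-! ### The vector lattice of regular operators -/

section RegularOperatorsLattice

set_option linter.unusedSectionVars false

variable {F E : Type*}
  [AddCommGroup F] [Module ℝ F] [Lattice F] [IsOrderedAddMonoid F]
  [AddCommGroup E] [Module ℝ E] [Lattice E] [IsOrderedAddMonoid E] [IsOrderedModule ℝ E]

theorem RegularOperators.nonneg_iff {T : RegularOperators F E} :
    0 ≤ T ↔ IsPositiveOperator T.1 := Iff.rfl

instance RegularOperators.instIsOrderedAddMonoid :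
    IsOrderedAddMonoid (RegularOperators F E) where
  add_le_add_left _ _ h R x hx := by
    simpa using h x hx

/-- A positive operator as a regular operator. -/
def IsPositiveOperator.regular {T : F →ₗ[ℝ] E} (hT : IsPositiveOperator T) :
    RegularOperators F E :=
  ⟨T, T, 0, hT, fun _ _ => le_rfl, by simp⟩

theorem IsPositiveOperator.mono {T : F →ₗ[ℝ] E} (hT : IsPositiveOperator T) {x y : F}
    (h : x ≤ y) : T x ≤ T y := by
  have := hT _ (sub_nonneg.2 h)
  rwa [map_sub, sub_nonneg] at this

theorem IsPositiveOperator.abs_apply_le {T : F →ₗ[ℝ] E} (hT : IsPositiveOperator T) (x : F) :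
    |T x| ≤ T |x| :=
  abs_le'.2 ⟨hT.mono (le_abs_self x), by rw [← map_neg]; exact hT.mono (neg_le_abs x)⟩

theorem NormalSeparating.eq_zero_of_nsmul_le (hS : NormalSeparating E) {x y : E} (hx : 0 ≤ x)
    (h : ∀ n : ℕ, n • x ≤ y) : x = 0 := by
  refine hS x fun φ hφ => ?_
  have h0 := hφ.pos x hx
  by_contra hne
  obtain ⟨n, hn⟩ := exists_nat_gt (φ y / φ x)
  have hpos : 0 < φ x := lt_of_le_of_ne h0 (Ne.symm hne)
  have h1 := hφ.pos.mono (h n)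
  rw [map_nsmul, nsmul_eq_mul] at h1
  rw [div_lt_iff₀ hpos] at hn
  linarith

/-- The supremum is `S + (T - S)⁺`, with the positive part given by the Riesz-Kantorovich formula.
Boundedness on order intervals comes from the positive operator `A` that dominates `T - S`. -/
theorem RegularOperators.exists_isLUB_pair [IsOrderedModule ℝ F] (hE : IsDedekindComplete E)
    (S T : RegularOperators F E) : ∃ R, IsLUB {S, T} R := by
  obtain ⟨A, B, hA, hB, hAB⟩ := (T - S).2
  obtain ⟨P, hP⟩ := exists_posPart_operator hE (T - S).1 (fun u hu => ⟨A u, by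
    rintro _ ⟨g, ⟨hg0, hg⟩, rfl⟩
    rw [hAB, LinearMap.sub_apply]
    exact (sub_le_self _ (hB g hg0)).trans (hA.mono hg)⟩)
  have hP0 : IsPositiveOperator P := fun u hu => (hP u hu).1 ⟨0, ⟨le_rfl, hu⟩, map_zero _⟩
  refine ⟨S + hP0.regular, ?_, ?_⟩
  · rintro R (rfl | rfl)
    · exact le_add_of_nonneg_right hP0
    · intro u hu
      have : (R - S).1 u ≤ P u := (hP u hu).1 ⟨u, ⟨hu, le_rfl⟩, rfl⟩
      exact sub_le_iff_le_add'.1 this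
  · intro R hR u hu
    have hSR : S ≤ R := hR (by simp)
    have hTR : T ≤ R := hR (by simp)
    have : P u ≤ R.1 u - S.1 u := (hP u hu).2 (by
      rintro _ ⟨g, ⟨hg0, hg⟩, rfl⟩
      have h1 : T.1 g - S.1 g ≤ R.1 g - S.1 g := sub_le_sub_right (hTR g hg0) _
      have h2 : (R - S).1 g ≤ (R - S).1 u :=
        IsPositiveOperator.mono (RegularOperators.nonneg_iff.1 (sub_nonneg.2 hSR)) hg
      exact h1.trans h2)
    exact le_sub_iff_add_le'.1 this

theorem RegularOperators.isVectorLattice [IsOrderedModule ℝ F] (hE : IsDedekindComplete E)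
    (hS : NormalSeparating E) : IsVectorLattice (RegularOperators F E) where
  add_le_add_right _ _ z h := add_le_add_left h z
  smul_le_smul r x y hr h u hu := smul_le_smul_of_nonneg_left (h u hu) hr
  exists_sup := exists_isLUB_pair hE
  exists_inf S T := by
    obtain ⟨R, hR⟩ := exists_isLUB_pair hE (-S) (-T)
    refine ⟨-R, ⟨?_, fun Q hQ => ?_⟩⟩
    · rintro Q (rfl | rfl)
      · exact neg_le.1 (hR.1 (by simp))
      · exact neg_le.1 (hR.1 (by simp))
    · refine le_neg.1 (hR.2 ?_)
      rintro _ (rfl | rfl)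
      · exact neg_le_neg (hQ (by simp))
      · exact neg_le_neg (hQ (by simp))
  archimedean S T h0 h := by
    have key : ∀ u, 0 ≤ u → S.1 u = 0 := fun u hu =>
      hS.eq_zero_of_nsmul_le (h0 u hu) fun n => by simpa using h n u hu
    apply Subtype.ext
    ext x
    rw [← posPart_sub_negPart x, map_sub, key _ (posPart_nonneg x), key _ (negPart_nonneg x)]
    simp

end RegularOperatorsLattice

/-! ### Moduli, and transport of structure along order preserving linear bijections -/

section Modulus

set_option linter.unusedSectionVars false

variable {V W : Type*} [AddCommGroup V] [Module ℝ V] [PartialOrder V]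
  [AddCommGroup W] [Module ℝ W] [PartialOrder W]

theorem IsVectorLattice.isLUB_modulus (hV : IsVectorLattice V) (x : V) :
    IsLUB {x, -x} (modulus x) := by
  have h := hV.exists_sup x (-x)
  rw [modulus, dif_pos h]
  exact h.choose_spec

theorem IsLUB.modulus_eq {x s : V} (h : IsLUB {x, -x} s) : modulus x = s := by
  have h' : ∃ s, IsLUB {x, -x} s := ⟨s, h⟩
  rw [modulus, dif_pos h']
  exact h'.choose_spec.unique h

theorem modulus_eq_abs {E : Type*} [AddCommGroup E] [Module ℝ E] [Lattice E]
    (x : E) : modulus x = |x| :=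
  IsLUB.modulus_eq isLUB_pair

theorem IsVectorLattice.isOrderedAddMonoid (hV : IsVectorLattice V) : IsOrderedAddMonoid V where
  add_le_add_left x y h z := hV.add_le_add_right x y z h

theorem IsVectorLattice.le_modulus (hV : IsVectorLattice V) (x : V) : x ≤ modulus x :=
  (hV.isLUB_modulus x).1 (by simp)

theorem IsVectorLattice.neg_le_modulus (hV : IsVectorLattice V) (x : V) : -x ≤ modulus x :=
  (hV.isLUB_modulus x).1 (by simp)

theorem IsVectorLattice.modulus_le (hV : IsVectorLattice V) {x y : V} (h1 : x ≤ y)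
    (h2 : -x ≤ y) : modulus x ≤ y :=
  (hV.isLUB_modulus x).2 (by rintro _ (rfl | rfl) <;> assumption)

theorem IsVectorLattice.modulus_nonneg (hV : IsVectorLattice V) (x : V) : 0 ≤ modulus x := by
  have := hV.isOrderedAddMonoid
  have h := add_le_add (hV.le_modulus x) (hV.neg_le_modulus x)
  rw [add_neg_cancel] at h
  have h2 := hV.smul_le_smul (1 / 2) _ _ (by norm_num) h
  rwa [smul_zero, ← two_smul ℝ, smul_smul, one_div, inv_mul_cancel₀ two_ne_zero, one_smul] at h2

theorem IsVectorLattice.modulus_of_nonneg (hV : IsVectorLattice V) {x : V} (hx : 0 ≤ x) :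
    modulus x = x := by
  have := hV.isOrderedAddMonoid
  exact (hV.modulus_le le_rfl ((neg_nonpos.2 hx).trans hx)).antisymm (hV.le_modulus x)

/-- A linear bijection that preserves and reflects the order, as an order isomorphism. -/
def LinearEquiv.toOrderIsoOfLe (I : V ≃ₗ[ℝ] W) (hI : ∀ x y, I x ≤ I y ↔ x ≤ y) : V ≃o W :=
  ⟨I.toEquiv, hI _ _⟩

theorem LinearEquiv.isLUB_pair_iff (I : V ≃ₗ[ℝ] W) (hI : ∀ x y, I x ≤ I y ↔ x ≤ y) (x y s : V) :
    IsLUB {x, y} s ↔ IsLUB {I x, I y} (I s) := by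
  have h := (I.toOrderIsoOfLe hI).isLUB_image' (s := {x, y}) (x := s)
  rw [Set.image_pair] at h
  exact h.symm

theorem LinearEquiv.isGLB_pair_iff (I : V ≃ₗ[ℝ] W) (hI : ∀ x y, I x ≤ I y ↔ x ≤ y) (x y s : V) :
    IsGLB {x, y} s ↔ IsGLB {I x, I y} (I s) := by
  have h := (I.toOrderIsoOfLe hI).isGLB_image' (s := {x, y}) (x := s)
  rw [Set.image_pair] at h
  exact h.symm

theorem LinearEquiv.isVectorLatticeIso (I : V ≃ₗ[ℝ] W) (hI : ∀ x y, I x ≤ I y ↔ x ≤ y) :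
    IsVectorLatticeIso I :=
  ⟨I.isLUB_pair_iff hI, I.isGLB_pair_iff hI⟩

theorem IsVectorLattice.of_linearEquiv (I : V ≃ₗ[ℝ] W) (hI : ∀ x y, I x ≤ I y ↔ x ≤ y)
    (hW : IsVectorLattice W) : IsVectorLattice V where
  add_le_add_right x y z h := by
    rw [← hI, map_add, map_add]
    exact hW.add_le_add_right _ _ _ ((hI x y).2 h)
  smul_le_smul r x y hr h := by
    rw [← hI, map_smul, map_smul]
    exact hW.smul_le_smul _ _ _ hr ((hI x y).2 h)
  exists_sup x y := by
    obtain ⟨s, hs⟩ := hW.exists_sup (I x) (I y)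
    exact ⟨I.symm s, (I.isLUB_pair_iff hI _ _ _).2 (by simpa using hs)⟩
  exists_inf x y := by
    obtain ⟨s, hs⟩ := hW.exists_inf (I x) (I y)
    exact ⟨I.symm s, (I.isGLB_pair_iff hI _ _ _).2 (by simpa using hs)⟩
  archimedean x y hx h := by
    have h0 : 0 ≤ I x := by rw [← map_zero I]; exact (hI _ _).2 hx
    have := hW.archimedean (I x) (I y) h0 fun n => by
      rw [← map_nsmul]; exact (hI _ _).2 (h n)
    simpa using this

theorem LinearEquiv.map_modulus (I : V ≃ₗ[ℝ] W) (hI : ∀ x y, I x ≤ I y ↔ x ≤ y)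
    (hV : IsVectorLattice V) (x : V) : modulus (I x) = I (modulus x) := by
  apply IsLUB.modulus_eq
  rw [← map_neg, ← I.isLUB_pair_iff hI]
  exact hV.isLUB_modulus x

theorem IsBanachLattice.of_linearEquiv (I : V ≃ₗ[ℝ] W) (hI : ∀ x y, I x ≤ I y ↔ x ≤ y)
    {N : V → ℝ} {M : W → ℝ} (hN : ∀ x, M (I x) = N x) (hW : IsBanachLattice W M) :
    IsBanachLattice V N where
  isVectorLattice := hW.isVectorLattice.of_linearEquiv I hI
  eq_zero_of_norm x hx := by
    have := hW.eq_zero_of_norm (I x) (by rw [hN, hx])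
    simpa using this
  norm_add_le x y := by
    rw [← hN, ← hN, ← hN, map_add]
    exact hW.norm_add_le _ _
  norm_smul r x := by
    rw [← hN, ← hN, map_smul]
    exact hW.norm_smul _ _
  solid x y h := by
    rw [← hN, ← hN]
    have hV := hW.isVectorLattice.of_linearEquiv I hI
    apply hW.solid
    rw [I.map_modulus hI hV, I.map_modulus hI hV]
    exact (hI _ _).2 h
  complete u hu := by
    obtain ⟨x, hx⟩ := hW.complete (fun n => I (u n)) (by simpa only [← map_sub, hN] using hu)
    refine ⟨I.symm x, ?_⟩
    refine hx.congr fun n => ?_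
    rw [← hN, map_sub, I.apply_symm_apply]

theorem IsALSpace.of_linearEquiv (I : V ≃ₗ[ℝ] W) (hI : ∀ x y, I x ≤ I y ↔ x ≤ y)
    {N : V → ℝ} {M : W → ℝ} (hN : ∀ x, M (I x) = N x) (hW : IsALSpace W M) :
    IsALSpace V N where
  isBanachLattice := hW.isBanachLattice.of_linearEquiv I hI hN
  norm_add x y hx hy := by
    rw [← hN, ← hN, ← hN, map_add]
    refine hW.norm_add _ _ ?_ ?_
    · rw [← map_zero I]; exact (hI _ _).2 hx
    · rw [← map_zero I]; exact (hI _ _).2 hy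

end Modulus

/-! ### KB-spaces are quasi-perfect -/

section KBSpace

variable {E : Type*} [NormedAddCommGroup E] [NormedSpace ℝ E] [Lattice E]
  [IsOrderedAddMonoid E] [IsOrderedModule ℝ E] [HasSolidNorm E]

set_option linter.unusedSectionVars false

theorem norm_le_norm_of_nonneg_of_le {x y : E} (hx : 0 ≤ x) (h : x ≤ y) : ‖x‖ ≤ ‖y‖ :=
  norm_le_norm_of_abs_le_abs (by rwa [abs_of_nonneg hx, abs_of_nonneg (hx.trans h)])

/-- In a KB-space, a norm bounded increasing net in the positive cone converges to its
supremum. -/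
theorem IsKBSpace.exists_isLUB_tendsto (hE : IsKBSpace E) {D : Set E} (hne : D.Nonempty)
    (hD : DirectedOn (· ≤ ·) D) (h0 : ∀ x ∈ D, 0 ≤ x) (hb : Bornology.IsBounded D) :
    ∃ s, IsLUB D s ∧ Tendsto (fun d : D => (d : E)) atTop (𝓝 s) := by
  obtain ⟨s, hs⟩ := hE D hne hD h0 hb
  have : Nonempty D := hne.to_subtype
  have : IsDirectedOrder D := ⟨fun a b => by
      obtain ⟨c, hc, h1, h2⟩ := hD a a.2 b b.2
      exact ⟨⟨c, hc⟩, h1, h2⟩⟩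
  refine ⟨s, ⟨fun d hd => ?_, fun b hb => ?_⟩, hs⟩
  · exact ge_of_tendsto hs ((eventually_ge_atTop ⟨d, hd⟩).mono fun _ h => h)
  · exact le_of_tendsto hs (Eventually.of_forall fun d => hb d.2)

theorem isBounded_Icc_of_hasSolidNorm (a b : E) : Bornology.IsBounded (Set.Icc a b) := by
  refine (Metric.isBounded_iff_subset_closedBall a).2 ⟨‖b - a‖, fun x hx => ?_⟩
  rw [Metric.mem_closedBall, dist_eq_norm]
  exact norm_le_norm_of_nonneg_of_le (sub_nonneg.2 hx.1) (sub_le_sub_right hx.2 _)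

/-- Order continuity of the norm: the elements `e - d` with `d ≤ e` increase, lie below `e` and so
converge in norm to their supremum, which is `e` because `D` has infimum `0`. -/
theorem IsKBSpace.exists_norm_lt (hE : IsKBSpace E) {D : Set E} (hne : D.Nonempty)
    (hD : DirectedOn (· ≥ ·) D) (h0 : IsGLB D 0) {ε : ℝ} (hε : 0 < ε) : ∃ d ∈ D, ‖d‖ < ε := by
  obtain ⟨e, he⟩ := hne
  set D' : Set E := {x | ∃ d ∈ D, d ≤ e ∧ x = e - d} with hD'
  have hne' : D'.Nonempty := ⟨_, e, he, le_rfl, rfl⟩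
  have hdir : DirectedOn (· ≤ ·) D' := by
    rintro _ ⟨a, ha, hae, rfl⟩ _ ⟨b, hb, hbe, rfl⟩
    obtain ⟨c, hc, h1, h2⟩ := hD a ha b hb
    exact ⟨_, ⟨c, hc, le_trans h1 hae, rfl⟩, sub_le_sub_left h1 _, sub_le_sub_left h2 _⟩
  obtain ⟨s, hs, ht⟩ := hE.exists_isLUB_tendsto hne' hdir
    (by rintro _ ⟨a, ha, hae, rfl⟩; exact sub_nonneg.2 hae)
    ((isBounded_Icc_of_hasSolidNorm 0 e).subset (by
      rintro _ ⟨a, ha, hae, rfl⟩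
      exact ⟨sub_nonneg.2 hae, sub_le_self _ (h0.1 ha)⟩))
  have hse : s = e := by
    apply le_antisymm
    · refine hs.2 ?_
      rintro _ ⟨a, ha, hae, rfl⟩
      exact sub_le_self _ (h0.1 ha)
    · have : e - s ≤ 0 := h0.2 (by
        intro d hd
        obtain ⟨c, hc, h1, h2⟩ := hD d hd e he
        exact (sub_le_comm.1 (hs.1 ⟨c, hc, h2, rfl⟩)).trans h1)
      exact sub_nonpos.1 this
  rw [hse] at ht
  have : Nonempty D' := hne'.to_subtype
  have : IsDirectedOrder D' := ⟨fun a b => by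
      obtain ⟨c, hc, h1, h2⟩ := hdir a a.2 b b.2
      exact ⟨⟨c, hc⟩, h1, h2⟩⟩
  obtain ⟨⟨_, d, hd, hde, rfl⟩, hx⟩ := (ht.eventually (Metric.ball_mem_nhds e hε)).exists
  refine ⟨d, hd, ?_⟩
  change dist (e - d) e < ε at hx
  rwa [dist_eq_norm, sub_sub_cancel_left, norm_neg] at hx

theorem IsKBSpace.isOrderContinuousFunctional (hE : IsKBSpace E) (φ : E →L[ℝ] ℝ) :
    IsOrderContinuousFunctional (φ : E →ₗ[ℝ] ℝ) where
  orderBounded a b := φ.lipschitz.isBounded_image (isBounded_Icc_of_hasSolidNorm a b)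
  tendsto D hne hD h0 := by
    have : Nonempty D := hne.to_subtype
    have : IsCodirectedOrder D := ⟨fun a b => by
      obtain ⟨c, hc, h1, h2⟩ := hD a a.2 b b.2
      exact ⟨⟨c, hc⟩, h1, h2⟩⟩
    have h : Tendsto (fun d : D => (d : E)) atBot (𝓝 0) := by
      refine Metric.tendsto_nhds.2 fun ε hε => ?_
      obtain ⟨d, hd, hlt⟩ := hE.exists_norm_lt hne hD h0 hε
      filter_upwards [eventually_le_atBot (⟨d, hd⟩ : D)] with x hx
      rw [dist_zero_right]
      exact (norm_le_norm_of_nonneg_of_le (h0.1 x.2) hx).trans_lt hlt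
    have h2 := (φ.continuous.tendsto 0).comp h
    rw [map_zero] at h2
    exact h2

/-- Normality is Hahn-Banach, as continuous functionals are order continuous. For suprema, every
continuous functional is a difference of positive ones, so `D` is weakly bounded, hence norm bounded
by Banach-Steinhaus in the bidual. -/
theorem IsKBSpace.isQuasiPerfect (hE : IsKBSpace E) : IsQuasiPerfect E where
  isNormal x hx := by
    obtain ⟨φ, -, hφ⟩ := exists_dual_vector ℝ x (norm_ne_zero_iff.2 hx)
    exact ⟨φ, hE.isOrderContinuousFunctional φ, by
      simpa [hφ] using hx⟩
  exists_isLUB D hne hD h0 hb := by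
    suffices h : Bornology.IsBounded D by
      obtain ⟨s, hs, -⟩ := hE.exists_isLUB_tendsto hne hD h0 h
      exact ⟨s, hs⟩
    obtain ⟨C, hC⟩ := banach_steinhaus
      (g := fun d : D => NormedSpace.inclusionInDoubleDual ℝ E d) (by
      intro φ
      have hφ := hE.isOrderContinuousFunctional φ
      obtain ⟨P, hP⟩ := exists_posPart_operator isDedekindComplete_real (φ : E →ₗ[ℝ] ℝ)
        fun u _ => (hφ.orderBounded 0 u).bddAbove
      have hP0 : IsPositiveFunctional P := fun u hu =>
        (hP u hu).1 ⟨0, ⟨le_rfl, hu⟩, map_zero _⟩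
      have hQ0 : IsPositiveFunctional (P - (φ : E →ₗ[ℝ] ℝ)) := fun u hu => by
        have : φ u ≤ P u := (hP u hu).1 ⟨u, ⟨hu, le_rfl⟩, rfl⟩
        simpa using this
      obtain ⟨a, ha⟩ := hb P hP0
      obtain ⟨b, hb⟩ := hb _ hQ0
      refine ⟨a + b, fun d => ?_⟩
      have h1 : P d ≤ a := ha ⟨d, d.2, rfl⟩
      have h2 : P d - φ d ≤ b := hb ⟨d, d.2, rfl⟩
      have h3 := hP0 d (h0 _ d.2)
      have h4 : 0 ≤ P d - φ d := hQ0 d (h0 _ d.2)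
      rw [NormedSpace.dual_def, Real.norm_eq_abs, abs_le]
      constructor <;> linarith)
    refine isBounded_iff_forall_norm_le.2 ⟨C, fun d hd => ?_⟩
    rw [← (NormedSpace.inclusionInDoubleDualLi ℝ (E := E)).norm_map d]
    exact hC ⟨d, hd⟩

end KBSpace

/-! ### Vector measures and order integrals under normal functionals -/

section ScalarMeasures

open MeasureTheory

set_option linter.unusedSectionVars false

variable {X : Type*} [MeasurableSpace X]
  {E : Type*} [AddCommGroup E] [Module ℝ E] [Lattice E] [IsOrderedAddMonoid E]
  [IsOrderedModule ℝ E]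
  {ν ν₁ ν₂ : {s : Set X // MeasurableSet s} → E} {φ : E →ₗ[ℝ] ℝ}

theorem directedOn_range_of_monotone {ι : Type*} [LinearOrder ι] {u : ι → E}
    (hu : Monotone u) : DirectedOn (· ≤ ·) (Set.range u) := by
  rintro _ ⟨m, rfl⟩ _ ⟨n, rfl⟩
  exact ⟨_, ⟨max m n, rfl⟩, hu (le_max_left _ _), hu (le_max_right _ _)⟩

theorem IsNormalFunctional.tendsto_of_isLUB_range (hφ : IsNormalFunctional φ) {u : ℕ → E} {a : E}
    (hu : Monotone u) (ha : IsLUB (Set.range u) a) :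
    Tendsto (fun n => φ (u n)) atTop (𝓝 (φ a)) := by
  have h := hφ.isLUB _ a (Set.range_nonempty u) (directedOn_range_of_monotone hu) ha
  rw [← Set.range_comp] at h
  exact tendsto_atTop_isLUB (fun m n hmn => hφ.pos.mono (hu hmn)) h

/-- The composition of a positive vector measure with a normal functional, as a measure. -/
noncomputable def IsPositiveMeasure.scalar (hν : IsPositiveMeasure ν)
    (hφ : IsNormalFunctional φ) : Measure X :=
  Measure.ofMeasurable (fun s hs => ENNReal.ofReal (φ (ν ⟨s, hs⟩))) (by
      rw [hν.empty, map_zero, ENNReal.ofReal_zero])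
    (by
      intro A hA hd
      have h := hφ.tendsto_of_isLUB_range (monotone_nat_of_le_succ fun n => by
        rw [Finset.sum_range_succ _ (n + 1)]
        exact le_add_of_nonneg_right (hν.nonneg _)) (hν.iUnion A hA hd)
      simp only [map_sum] at h
      have hs : HasSum (fun n => φ (ν ⟨A n, hA n⟩)) (φ (ν ⟨_, MeasurableSet.iUnion hA⟩)) := by
        rw [hasSum_iff_tendsto_nat_of_nonneg fun n => hφ.pos _ (hν.nonneg _)]
        -- The partial sums in `iUnion` start with one term, hence the shift by one.
        exact (tendsto_add_atTop_iff_nat 1).1 h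
      rw [← hs.tsum_eq]
      exact ENNReal.ofReal_tsum_of_nonneg (fun n => hφ.pos _ (hν.nonneg _)) hs.summable)

theorem IsPositiveMeasure.scalar_apply (hν : IsPositiveMeasure ν)
    (hφ : IsNormalFunctional φ) {s : Set X} (hs : MeasurableSet s) :
    hν.scalar hφ s = ENNReal.ofReal (φ (ν ⟨s, hs⟩)) :=
  Measure.ofMeasurable_apply s hs

theorem IsPositiveMeasure.real_scalar (hν : IsPositiveMeasure ν)
    (hφ : IsNormalFunctional φ) (s : {s : Set X // MeasurableSet s}) :
    φ (ν s) = (hν.scalar hφ).real s.1 := by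
  rw [measureReal_def, hν.scalar_apply hφ s.2, ENNReal.toReal_ofReal (hφ.pos _ (hν.nonneg _))]

instance IsPositiveMeasure.isFiniteMeasure_scalar (hν : IsPositiveMeasure ν)
    (hφ : IsNormalFunctional φ) : IsFiniteMeasure (hν.scalar hφ) :=
  ⟨by rw [hν.scalar_apply hφ MeasurableSet.univ]; exact ENNReal.ofReal_lt_top⟩

theorem lintegral_simpleFunc (m : Measure X) (ψ : SimpleFunc X ℝ≥0) :
    ∫⁻ x, ψ x ∂m = (ψ.map ((↑) : ℝ≥0 → ENNReal)).lintegral m := by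
  rw [← SimpleFunc.lintegral_eq_lintegral]; rfl

theorem lintegral_simpleFunc_ne_top (m : Measure X) [IsFiniteMeasure m] (ψ : SimpleFunc X ℝ≥0) :
    ∫⁻ x, ψ x ∂m ≠ ⊤ := by
  rw [lintegral_simpleFunc, SimpleFunc.map_lintegral]
  exact ENNReal.sum_ne_top.2 fun r _ => by finiteness

theorem apply_elementaryIntegral {m : Measure X} [IsFiniteMeasure m]
    (h : ∀ s : {s : Set X // MeasurableSet s}, φ (ν s) = m.real s.1) (ψ : SimpleFunc X ℝ≥0) :
    φ (elementaryIntegral ν ψ) = (∫⁻ x, ψ x ∂m).toReal := by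
  rw [lintegral_simpleFunc, SimpleFunc.map_lintegral, ENNReal.toReal_sum (fun r _ => by finiteness),
    elementaryIntegral, map_sum]
  refine Finset.sum_congr rfl fun r _ => ?_
  rw [map_smul, h, ENNReal.toReal_mul, ENNReal.coe_toReal, measureReal_def, smul_eq_mul]

theorem elementaryIntegral_nonneg (hν : ∀ s, 0 ≤ ν s) (ψ : SimpleFunc X ℝ≥0) :
    0 ≤ elementaryIntegral ν ψ :=
  Finset.sum_nonneg fun r _ => smul_nonneg r.2 (hν _)

/-- Checking additivity for `χ = ψ + (χ - ψ)` under normal functionals replaces common refinements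
of partitions. The integral of `χ - ψ` is then visibly positive. -/
theorem IsPositiveMeasure.elementaryIntegral_mono (hS : NormalSeparating E)
    (hν : IsPositiveMeasure ν) {ψ χ : SimpleFunc X ℝ≥0} (h : ∀ x, ψ x ≤ χ x) :
    elementaryIntegral ν ψ ≤ elementaryIntegral ν χ := by
  have h1 : elementaryIntegral ν χ = elementaryIntegral ν ψ + elementaryIntegral ν (χ - ψ) := by
    refine hS.ext fun φ hφ => ?_
    have hm := hν.real_scalar hφ
    rw [map_add, apply_elementaryIntegral hm, apply_elementaryIntegral hm,
      apply_elementaryIntegral hm, ← ENNReal.toReal_add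
        (lintegral_simpleFunc_ne_top _ _) (lintegral_simpleFunc_ne_top _ _),
      ← lintegral_add_left (by fun_prop)]
    congr 2 with x
    rw [SimpleFunc.coe_sub, Pi.sub_apply, ← ENNReal.coe_add, add_tsub_cancel_of_le (h x)]
  rw [h1]
  exact le_add_of_nonneg_right (elementaryIntegral_nonneg hν.nonneg _)

theorem IsPositiveMeasure.elementaryIntegral_const (hS : NormalSeparating E)
    (hν : IsPositiveMeasure ν) (r : ℝ≥0) :
    elementaryIntegral ν (SimpleFunc.const X r) = (r : ℝ) • ν ⟨Set.univ, MeasurableSet.univ⟩ := by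
  refine hS.ext fun φ hφ => ?_
  rw [apply_elementaryIntegral (hν.real_scalar hφ), map_smul, hν.real_scalar hφ]
  simp [measureReal_def]

/-- Monotone convergence. The right-hand side does not involve the approximating sequence, so normal
functionals force the order integral to be unique. -/
theorem IsPositiveMeasure.apply_eq_of_hasPositiveOrderIntegral (hS : NormalSeparating E)
    (hν : IsPositiveMeasure ν) (hφ : IsNormalFunctional φ) {f : X → ℝ} {a : E}
    (h : HasPositiveOrderIntegral ν f a) :
    φ a = (∫⁻ x, ENNReal.ofReal (f x) ∂(hν.scalar hφ)).toReal := by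
  obtain ⟨ψ, hmono, hlim, ha⟩ := h
  have h1 := hφ.tendsto_of_isLUB_range
    (fun m n hmn => hν.elementaryIntegral_mono hS fun x => hmono x hmn) ha
  have h2 : Tendsto (fun n => ∫⁻ x, ψ n x ∂(hν.scalar hφ)) atTop
      (𝓝 (∫⁻ x, ENNReal.ofReal (f x) ∂(hν.scalar hφ))) := by
    refine lintegral_tendsto_of_tendsto_of_monotone (fun n => by fun_prop)
      (Eventually.of_forall fun x m n hmn => ENNReal.coe_le_coe.2 (hmono x hmn))
      (Eventually.of_forall fun x => ?_)
    have := (ENNReal.continuous_ofReal.tendsto _).comp (hlim x)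
    simpa [Function.comp_def] using this
  have h3 : ∀ n, ∫⁻ x, ψ n x ∂(hν.scalar hφ) =
      ENNReal.ofReal (φ (elementaryIntegral ν (ψ n))) := fun n => by
    rw [apply_elementaryIntegral (hν.real_scalar hφ),
      ENNReal.ofReal_toReal (lintegral_simpleFunc_ne_top _ _)]
  have h4 := (ENNReal.continuous_ofReal.tendsto _).comp h1
  simp only [h3] at h2
  rw [tendsto_nhds_unique h2 h4, ENNReal.toReal_ofReal]
  exact ge_of_tendsto' h1 fun n => hφ.pos _ (elementaryIntegral_nonneg hν.nonneg _)

theorem exists_simpleFunc_tendsto {f : X → ℝ} (hf : Measurable f) (h0 : ∀ x, 0 ≤ f x) :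
    ∃ ψ : ℕ → SimpleFunc X ℝ≥0, (∀ x, Monotone fun n => ψ n x) ∧
      (∀ x, Tendsto (fun n => (ψ n x : ℝ)) atTop (𝓝 (f x))) ∧ ∀ n x, (ψ n x : ℝ) ≤ f x := by
  set g : X → ENNReal := fun x => ENNReal.ofReal (f x) with hg
  have hgm : Measurable g := hf.ennreal_ofReal
  have hle : ∀ n x, SimpleFunc.eapprox g n x ≤ g x := fun n x => by
    rw [← SimpleFunc.iSup_eapprox_apply hgm x]
    exact le_iSup (fun n => SimpleFunc.eapprox g n x) n
  refine ⟨fun n => (SimpleFunc.eapprox g n).map ENNReal.toNNReal, fun x m n hmn => ?_,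
    fun x => ?_, fun n x => ?_⟩
  · exact ENNReal.toNNReal_mono (SimpleFunc.eapprox_lt_top _ _ _).ne
      (SimpleFunc.monotone_eapprox g hmn x)
  · have h1 : Tendsto (fun n => SimpleFunc.eapprox g n x) atTop (𝓝 (g x)) := by
      rw [← SimpleFunc.iSup_eapprox_apply hgm x]
      exact tendsto_atTop_iSup fun m n hmn => SimpleFunc.monotone_eapprox g hmn x
    have h2 := (ENNReal.tendsto_toReal (ENNReal.ofReal_ne_top (r := f x))).comp h1
    rw [ENNReal.toReal_ofReal (h0 x)] at h2
    exact h2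
  · have := ENNReal.toReal_mono (ENNReal.ofReal_ne_top (r := f x)) (hle n x)
    rwa [hg, ENNReal.toReal_ofReal (h0 x)] at this

/-- The elementary integrals are bounded by that of the constant `C`, so Dedekind completeness gives
their supremum. -/
theorem IsPositiveMeasure.exists_hasPositiveOrderIntegral (hE : IsDedekindComplete E)
    (hS : NormalSeparating E) (hν : IsPositiveMeasure ν) {f : X → ℝ} (hf : Measurable f)
    (h0 : ∀ x, 0 ≤ f x) {C : ℝ≥0} (hC : ∀ x, f x ≤ C) :
    ∃ a, HasPositiveOrderIntegral ν f a ∧ 0 ≤ a ∧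
      a ≤ (C : ℝ) • ν ⟨Set.univ, MeasurableSet.univ⟩ := by
  obtain ⟨ψ, hmono, hlim, hle⟩ := exists_simpleFunc_tendsto hf h0
  have hub : (C : ℝ) • ν ⟨Set.univ, MeasurableSet.univ⟩ ∈
      upperBounds (Set.range fun n => elementaryIntegral ν (ψ n)) := by
    rintro _ ⟨n, rfl⟩
    rw [← hν.elementaryIntegral_const hS]
    exact hν.elementaryIntegral_mono hS fun x => NNReal.coe_le_coe.1 ((hle n x).trans (hC x))
  obtain ⟨a, ha⟩ := hE _ (Set.range_nonempty _) ⟨_, hub⟩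
  exact ⟨a, ⟨ψ, hmono, hlim, ha⟩,
    (elementaryIntegral_nonneg hν.nonneg _).trans (ha.1 ⟨0, rfl⟩), ha.2 hub⟩

theorem IsPositiveMeasure.apply_eq_of_hasOrderIntegral (hS : NormalSeparating E)
    (hν : IsPositiveMeasure ν) (hφ : IsNormalFunctional φ) {f : X → ℝ}
    (hf : Integrable f (hν.scalar hφ)) {a : E} (h : HasOrderIntegral ν f a) :
    φ a = ∫ x, f x ∂(hν.scalar hφ) := by
  obtain ⟨b, c, hb, hc, rfl⟩ := h
  rw [map_sub, hν.apply_eq_of_hasPositiveOrderIntegral hS hφ hb,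
    hν.apply_eq_of_hasPositiveOrderIntegral hS hφ hc,
    integral_eq_lintegral_pos_part_sub_lintegral_neg_part hf]
  have e : ∀ r : ℝ, ENNReal.ofReal (max r 0) = ENNReal.ofReal r := fun r => by
    rcases le_total r 0 with h | h <;> simp [h, ENNReal.ofReal_of_nonpos]
  simp only [e]

/-- Scalar criterion for a set map to be a positive measure. -/
theorem IsPositiveMeasure.of_scalar (hE : IsDedekindComplete E) (hS : NormalSeparating E)
    (h0 : ∀ s, 0 ≤ ν s)
    (h : ∀ φ : E →ₗ[ℝ] ℝ, IsNormalFunctional φ → ∃ m : Measure X, IsFiniteMeasure m ∧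
      ∀ s, φ (ν s) = m.real s.1) : IsPositiveMeasure ν where
  nonneg := h0
  empty := hS _ fun φ hφ => by
    obtain ⟨m, hm, hmν⟩ := h φ hφ
    rw [hmν, measureReal_empty]
  iUnion A hA hd := by
    have hmono : Monotone fun N : ℕ => ∑ n ∈ Finset.range (N + 1), ν ⟨A n, hA n⟩ :=
      monotone_nat_of_le_succ fun n => by
        rw [Finset.sum_range_succ _ (n + 1)]
        exact le_add_of_nonneg_right (h0 _)
    refine hS.isLUB_of_scalar hE (Set.range_nonempty _) (directedOn_range_of_monotone hmono) ?_ ?_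
    · rintro _ ⟨N, rfl⟩
      -- Normal functionals are only known to separate points, not to determine the order. The
      -- inequality is therefore obtained by exhibiting the difference as the value of `ν` on the
      -- remaining set, which is positive by `h0`.
      have hB : MeasurableSet ((⋃ n, A n) \ ⋃ n ∈ Finset.range (N + 1), A n) :=
        (MeasurableSet.iUnion hA).diff (Finset.measurableSet_biUnion _ fun n _ => hA n)
      have e : ν ⟨⋃ n, A n, MeasurableSet.iUnion hA⟩ =
          ∑ n ∈ Finset.range (N + 1), ν ⟨A n, hA n⟩ + ν ⟨_, hB⟩ := by
        refine hS.ext fun φ hφ => ?_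
        obtain ⟨m, hm, hmν⟩ := h φ hφ
        simp only [map_add, map_sum, hmν]
        rw [← measureReal_biUnion_finset (fun i _ j _ hij => hd hij) fun n _ => hA n, measureReal_add_sdiff
            (Finset.measurableSet_biUnion _ fun n _ => hA n) (measure_ne_top _ _) (measure_ne_top _ _),
          Set.union_eq_right.2]
        exact Set.iUnion₂_subset fun n _ => Set.subset_iUnion A n
      rw [e]
      exact le_add_of_nonneg_right (h0 _)
    · intro φ hφ
      obtain ⟨m, hm, hmν⟩ := h φ hφ
      rw [← Set.range_comp]
      refine isLUB_of_tendsto_atTop (fun i j hij => hφ.pos.mono (hmono hij)) ?_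
      have h1 : HasSum (fun n => m.real (A n)) (m.real (⋃ n, A n)) := by
        have h2 : ∑' n, m (A n) ≠ ⊤ := by
          rw [← measure_iUnion hd hA]
          exact measure_ne_top _ _
        have h3 := ENNReal.hasSum_toReal h2
        rw [← ENNReal.tsum_toReal_eq fun n => measure_ne_top _ _, ← measure_iUnion hd hA] at h3
        exact h3
      simp only [Function.comp_def, map_sum, hmν]
      exact (tendsto_add_atTop_iff_nat 1).2 h1.tendsto_sum_nat

end ScalarMeasures

/-! ### Automatic continuity of positive operators -/

section AutomaticContinuity

variable {F E : Type*}
  [NormedAddCommGroup F] [NormedSpace ℝ F] [CompleteSpace F] [Lattice F] [IsOrderedAddMonoid F]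
  [IsOrderedModule ℝ F] [HasSolidNorm F]
  [NormedAddCommGroup E] [NormedSpace ℝ E] [Lattice E] [IsOrderedAddMonoid E]
  [IsOrderedModule ℝ E] [HasSolidNorm E]

/-- A positive operator on a Banach lattice is bounded. -/
theorem IsPositiveOperator.exists_bound {T : F →ₗ[ℝ] E} (hT : IsPositiveOperator T) :
    ∃ C : ℝ, 0 ≤ C ∧ ∀ x, ‖T x‖ ≤ C * ‖x‖ := by
  by_contra! hcon
  -- Normalising `|x n|` to norm `2⁻ⁿ` gives a summable sequence `y` whose images still have norm
  -- above `2ⁿ`. Positivity bounds all these images by the image of the sum of `y`.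
  have h4 : ∀ n : ℕ, ∃ x, (4 : ℝ) ^ n * ‖x‖ < ‖T x‖ := fun n => hcon _ (by positivity)
  choose x hx using h4
  have hx0 : ∀ n, 0 < ‖x n‖ := fun n => norm_pos_iff.2 fun h => by
    have := hx n
    simp [h] at this
  set y : ℕ → F := fun n => ((2 : ℝ) ^ n * ‖x n‖)⁻¹ • |x n| with hy
  have hy0 : ∀ n, 0 ≤ y n := fun n => smul_nonneg (by positivity) (abs_nonneg _)
  have hyn : ∀ n, ‖y n‖ = (1 / 2 : ℝ) ^ n := fun n => by
    have := (hx0 n).ne'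
    rw [hy, norm_smul, norm_abs_eq_norm, Real.norm_of_nonneg (by positivity)]
    field_simp
    rw [← mul_pow]
    norm_num
  have hsum : Summable y := Summable.of_norm (by
    simp only [hyn]
    exact summable_geometric_two)
  obtain ⟨n, hn⟩ := pow_unbounded_of_one_lt ‖T (∑' n, y n)‖ (one_lt_two (α := ℝ))
  have h1 : ‖T (y n)‖ ≤ ‖T (∑' n, y n)‖ :=
    norm_le_norm_of_abs_le_abs (by
      have h := hT.mono (hsum.le_tsum n fun j _ => hy0 j)
      rwa [abs_of_nonneg (hT _ (hy0 n)), abs_of_nonneg ((hT _ (hy0 n)).trans h)])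
  have h2 : (2 : ℝ) ^ n < ‖T (y n)‖ := by
    have h3 : ‖T (x n)‖ ≤ ‖T |x n|‖ := by
      rw [← norm_abs_eq_norm (T (x n)), ← norm_abs_eq_norm (T |x n|)]
      refine norm_le_norm_of_abs_le_abs ?_
      rw [abs_abs, abs_abs]
      exact (hT.abs_apply_le _).trans (le_abs_self _)
    have h5 := (hx n).trans_le h3
    have := hx0 n
    rw [hy, map_smul, norm_smul, Real.norm_of_nonneg (by positivity), ← div_eq_inv_mul,
      lt_div_iff₀ (by positivity), ← mul_assoc, ← mul_pow]
    norm_num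
    exact h5
  linarith

end AutomaticContinuity

/-! ### Functions vanishing at infinity and the scalar Riesz theorem -/

section ZeroAtInftyLattice

set_option linter.unusedSectionVars false

open MeasureTheory CompactlySupported

variable {X : Type*} [TopologicalSpace X]

theorem ZeroAtInftyContinuousMap.sup_apply (f g : C₀(X, ℝ)) (x : X) :
    (f ⊔ g) x = f x ⊔ g x := rfl

theorem ZeroAtInftyContinuousMap.abs_apply_le_norm (f : C₀(X, ℝ)) (x : X) : |f x| ≤ ‖f‖ :=
  f.toBCF.norm_coe_le_norm x

theorem ZeroAtInftyContinuousMap.norm_le_of_forall {f : C₀(X, ℝ)} {C : ℝ} (hC : 0 ≤ C)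
    (h : ∀ x, |f x| ≤ C) : ‖f‖ ≤ C :=
  (f.toBCF.norm_le hC).2 h

instance : IsOrderedModule ℝ C₀(X, ℝ) where
  smul_le_smul_of_nonneg_left _ hc _ _ h x := mul_le_mul_of_nonneg_left (h x) hc
  smul_le_smul_of_nonneg_right _ hf _ _ h x := mul_le_mul_of_nonneg_right h (hf x)

instance : HasSolidNorm C₀(X, ℝ) :=
  ⟨fun _ g h => ZeroAtInftyContinuousMap.norm_le_of_forall (norm_nonneg _) fun x =>
    (h x).trans (g.abs_apply_le_norm x)⟩

/-- The inclusion of the compactly supported functions in `C₀(X)`. -/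
def CompactlySupportedContinuousMap.toZeroAtInfty : C_c(X, ℝ) →ₗ[ℝ] C₀(X, ℝ) where
  toFun f := ⟨f.toContinuousMap, f.hasCompactSupport.is_zero_at_infty⟩
  map_add' _ _ := rfl
  map_smul' _ _ := rfl

/-- Compactly supported functions are dense in `C₀(X)`. -/
theorem ZeroAtInftyContinuousMap.exists_norm_sub_toZeroAtInfty_le [R1Space X] (f : C₀(X, ℝ))
    {ε : ℝ} (hε : 0 < ε) : ∃ g : C_c(X, ℝ), ‖f - g.toZeroAtInfty‖ ≤ ε := by
  obtain ⟨K, hK, hKf⟩ := mem_cocompact.1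
    ((zero_at_infty f).eventually (Metric.ball_mem_nhds (0 : ℝ) hε))
  -- Subtracting the truncation of `f` to `[-ε, ε]` costs at most `ε` and leaves a function that
  -- vanishes wherever `|f| < ε`.
  have hcont : Continuous fun x => f x - max (-ε) (min ε (f x)) := by fun_prop
  refine ⟨⟨⟨_, hcont⟩, HasCompactSupport.intro hK fun x hx => ?_⟩,
    norm_le_of_forall hε.le fun x => ?_⟩
  · have h : dist (f x) 0 < ε := hKf hx
    rw [dist_zero_right, Real.norm_eq_abs, abs_lt] at h
    change f x - max (-ε) (min ε (f x)) = 0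
    rw [min_eq_right h.2.le, max_eq_right h.1.le, sub_self]
  · change |f x - (f x - max (-ε) (min ε (f x)))| ≤ ε
    rw [sub_sub_cancel, abs_le]
    exact ⟨le_max_left _ _, max_le (by linarith) (min_le_left _ _)⟩

/-- Urysohn's lemma with a function in `C₀(X)`. -/
theorem ZeroAtInftyContinuousMap.exists_eq_one_of_isCompact [T2Space X] [LocallyCompactSpace X]
    {K V : Set X} (hK : IsCompact K) (hV : IsOpen V) (hKV : K ⊆ V) :
    ∃ f : C₀(X, ℝ), 0 ≤ f ∧ (∀ x ∈ K, f x = 1) ∧ (∀ x ∉ V, f x = 0) ∧ ∀ x, f x ≤ 1 := by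
  obtain ⟨f, h1, h2, h3, h4⟩ := exists_continuous_one_zero_of_isCompact hK hV.isClosed_compl
    (Set.disjoint_compl_right_iff_subset.2 hKV)
  exact ⟨⟨f, h3.is_zero_at_infty⟩, fun x => (h4 x).1, h1, h2, fun x => (h4 x).2⟩

variable [MeasurableSpace X]

theorem ZeroAtInftyContinuousMap.integrable [BorelSpace X] (f : C₀(X, ℝ)) (m : Measure X)
    [IsFiniteMeasure m] : Integrable (fun x => f x) m :=
  f.toBCF.integrable m

/-- Integration as a linear functional on `C₀(X)`. -/
noncomputable def ZeroAtInftyContinuousMap.integral [BorelSpace X] (m : Measure X)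
    [IsFiniteMeasure m] : C₀(X, ℝ) →ₗ[ℝ] ℝ where
  toFun f := ∫ x, f x ∂m
  map_add' f g := integral_add (f.integrable m) (g.integrable m)
  map_smul' c _ := integral_const_mul c _

theorem isLUB_measureReal_isCompact [BorelSpace X] (m : Measure X) [IsFiniteMeasure m] [m.Regular] {V : Set X}
    (hV : IsOpen V) : IsLUB {r | ∃ K, IsCompact K ∧ K ⊆ V ∧ r = m.real K} (m.real V) := by
  refine ⟨?_, fun b hb => ?_⟩
  · rintro _ ⟨K, -, hKV, rfl⟩
    exact measureReal_mono hKV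
  · have hb0 : 0 ≤ b := by simpa using hb ⟨∅, isCompact_empty, Set.empty_subset V, rfl⟩
    rw [measureReal_def]
    refine ENNReal.toReal_le_of_le_ofReal hb0 ?_
    rw [hV.measure_eq_iSup_isCompact]
    refine iSup₂_le fun K hKV => iSup_le fun hK => ?_
    exact (ENNReal.le_ofReal_iff_toReal_le (measure_ne_top _ _) hb0).2 (hb ⟨K, hK, hKV, rfl⟩)

theorem isGLB_measureReal_isOpen [BorelSpace X] (m : Measure X) [IsFiniteMeasure m] [m.Regular] (A : Set X) :
    IsGLB {r | ∃ V, IsOpen V ∧ A ⊆ V ∧ r = m.real V} (m.real A) := by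
  refine ⟨?_, fun b hb => ?_⟩
  · rintro _ ⟨V, -, hAV, rfl⟩
    exact measureReal_mono hAV
  · rcases le_or_gt b 0 with h0 | h0
    · exact h0.trans measureReal_nonneg
    · rw [measureReal_def, ← ENNReal.ofReal_le_iff_le_toReal (measure_ne_top _ _),
        A.measure_eq_iInf_isOpen]
      refine le_iInf₂ fun V hAV => le_iInf fun hV => ?_
      exact (ENNReal.ofReal_le_iff_le_toReal (measure_ne_top _ _)).2 (hb ⟨V, hV, hAV, rfl⟩)

theorem measure_eq_of_measureReal_eq {X : Type*} [MeasurableSpace X] {m₁ m₂ : Measure X}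
    [IsFiniteMeasure m₁] [IsFiniteMeasure m₂]
    (h : ∀ s, MeasurableSet s → m₁.real s = m₂.real s) : m₁ = m₂ :=
  Measure.ext fun s hs => (ENNReal.toReal_eq_toReal_iff' (measure_ne_top _ _)
    (measure_ne_top _ _)).1 (h s hs)

/-- For finite measures, regularity can be expressed by smallness of `U \ A` and `V \ K`, and
smallness for `m₁` implies smallness for `m₂`. -/
theorem regular_of_le [T2Space X] [BorelSpace X] {m₁ m₂ : Measure X} [IsFiniteMeasure m₁]
    [m₁.Regular] (h : m₂ ≤ m₁) : m₂.Regular := by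
  have hfin : IsFiniteMeasure m₂ := isFiniteMeasure_of_le m₁ h
  have houter : m₂.OuterRegular := by
    refine ⟨fun A hA r hr => ?_⟩
    obtain ⟨U, hAU, hU, -, hlt⟩ := hA.exists_isOpen_sdiff_lt (μ := m₁) (measure_ne_top _ _)
      (tsub_pos_of_lt hr).ne'
    refine ⟨U, hAU, hU, ?_⟩
    calc m₂ U ≤ m₂ A + m₂ (U \ A) := by
          conv_lhs => rw [← Set.union_sdiff_cancel hAU]
          exact measure_union_le _ _
      _ < r := lt_tsub_iff_left.1 ((h _).trans_lt hlt)
  refine { houter with lt_top_of_isCompact := fun K _ => measure_lt_top _ _, innerRegular := ?_ }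
  intro V hV r hr
  obtain ⟨K, hKV, hK, hlt⟩ := hV.measurableSet.exists_isCompact_sdiff_lt (μ := m₁)
    (measure_ne_top _ _) (tsub_pos_of_lt hr).ne'
  refine ⟨K, hKV, hK, lt_of_not_ge fun hle => ?_⟩
  have h1 : m₂ V ≤ m₂ K + m₂ (V \ K) := by
    conv_lhs => rw [← Set.union_sdiff_cancel hKV]
    exact measure_union_le _ _
  have h2 := lt_tsub_iff_left.1 ((h _).trans_lt hlt)
  exact absurd (h1.trans (add_le_add_left hle _)) (not_le.2 h2)

variable [T2Space X] [LocallyCompactSpace X] [BorelSpace X]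

/-- The Riesz representation theorem for positive functionals on `C₀(X)`. -/
theorem exists_regular_measure_of_isPositiveOperator {Λ : C₀(X, ℝ) →ₗ[ℝ] ℝ}
    (hΛ : IsPositiveOperator Λ) :
    ∃ m : Measure X, IsFiniteMeasure m ∧ m.Regular ∧ ∀ f : C₀(X, ℝ), Λ f = ∫ x, f x ∂m := by
  set L : C_c(X, ℝ) →ₚ[ℝ] ℝ := PositiveLinearMap.mk₀
    (Λ ∘ₗ CompactlySupportedContinuousMap.toZeroAtInfty) (fun _ hf => hΛ _ hf) with hL
  have hLa : ∀ f, L f = Λ f.toZeroAtInfty := fun _ => rfl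
  obtain ⟨C, hC0, hC⟩ := hΛ.exists_bound
  -- A Urysohn function equal to `1` on `K` has norm at most `1`, so every compact set has mass at
  -- most `C`.
  have hfin : IsFiniteMeasure (RealRMK.rieszMeasure L) := by
    refine ⟨lt_of_le_of_lt ?_ (ENNReal.ofReal_lt_top (r := C))⟩
    rw [isOpen_univ.measure_eq_iSup_isCompact]
    refine iSup₂_le fun K _ => iSup_le fun hK => ?_
    obtain ⟨f, h1, -, h3, h4⟩ := exists_continuous_one_zero_of_isCompact hK isClosed_empty
      (Set.disjoint_empty K)
    refine (RealRMK.rieszMeasure_le_of_eq_one L (f := ⟨f, h3⟩) (fun x => (h4 x).1) hK h1).trans ?_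
    refine ENNReal.ofReal_le_ofReal ?_
    rw [hLa]
    refine (le_abs_self _).trans ((hC _).trans (mul_le_of_le_one_right hC0 ?_))
    exact ZeroAtInftyContinuousMap.norm_le_of_forall zero_le_one fun x => by
      change |f x| ≤ 1
      rw [abs_of_nonneg (h4 x).1]
      exact (h4 x).2
  refine ⟨RealRMK.rieszMeasure L, hfin, inferInstance, fun f => ?_⟩
  set J := ZeroAtInftyContinuousMap.integral (RealRMK.rieszMeasure L) with hJ
  have hJpos : IsPositiveOperator J := fun f hf => integral_nonneg hf
  obtain ⟨C', hC0', hC'⟩ := hJpos.exists_bound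
  change Λ f = J f
  rw [← sub_eq_zero, ← norm_le_zero_iff]
  refine le_of_forall_pos_le_add fun δ hδ => ?_
  -- The functionals `Λ` and `J` agree on compactly supported functions and are bounded, so density
  -- suffices; the `+ 1` keeps the denominator positive.
  obtain ⟨g, hg⟩ := f.exists_norm_sub_toZeroAtInfty_le
    (show 0 < δ / (C + C' + 1) by positivity)
  have hgeq : Λ g.toZeroAtInfty = J g.toZeroAtInfty := by
    rw [← hLa, ← RealRMK.integral_rieszMeasure L g]
    rfl
  have e : Λ f - J f = Λ (f - g.toZeroAtInfty) - J (f - g.toZeroAtInfty) := by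
    rw [map_sub, map_sub, hgeq]
    ring
  rw [e, zero_add]
  calc _ ≤ _ := norm_sub_le _ _
    _ ≤ C * ‖f - g.toZeroAtInfty‖ + C' * ‖f - g.toZeroAtInfty‖ := add_le_add (hC _) (hC' _)
    _ = (C + C') * ‖f - g.toZeroAtInfty‖ := by ring
    _ ≤ (C + C' + 1) * (δ / (C + C' + 1)) := by gcongr ?_ * ?_; linarith
    _ = δ := by field_simp

theorem measure_eq_of_integral_zeroAtInfty_eq {m₁ m₂ : Measure X} [m₁.Regular]
    [m₂.Regular] (h : ∀ f : C₀(X, ℝ), ∫ x, f x ∂m₁ = ∫ x, f x ∂m₂) : m₁ = m₂ :=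
  Measure.ext_of_integral_eq_on_compactlySupported fun f => h f.toZeroAtInfty

end ZeroAtInftyLattice

/-! ### Regularity under normal functionals and the representing measure -/

section RegularMeasures

open MeasureTheory

set_option linter.unusedSectionVars false

variable {X : Type*} [TopologicalSpace X] [T2Space X] [MeasurableSpace X] [BorelSpace X]
  {E : Type*} [AddCommGroup E] [Module ℝ E] [Lattice E] [IsOrderedAddMonoid E]
  [IsOrderedModule ℝ E]
  {ν ν₁ ν₂ : {s : Set X // MeasurableSet s} → E} {φ : E →ₗ[ℝ] ℝ}

theorem mono_of_scalar {X : Type*} [MeasurableSpace X] {ν : {s : Set X // MeasurableSet s} → E}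
    (hS : NormalSeparating E) (h0 : ∀ s, 0 ≤ ν s)
    (h : ∀ φ : E →ₗ[ℝ] ℝ, IsNormalFunctional φ → ∃ m : Measure X, IsFiniteMeasure m ∧
      ∀ s, φ (ν s) = m.real s.1) {s t : {s : Set X // MeasurableSet s}} (hst : s.1 ⊆ t.1) :
    ν s ≤ ν t := by
  have e : ν t = ν s + ν ⟨t.1 \ s.1, t.2.diff s.2⟩ := by
    refine hS.ext fun φ hφ => ?_
    obtain ⟨m, hm, hmν⟩ := h φ hφ
    rw [map_add, hmν, hmν, hmν, measureReal_add_sdiff s.2 (measure_ne_top _ _)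
      (measure_ne_top _ _), Set.union_eq_right.2 hst]
  rw [e]
  exact le_add_of_nonneg_right (h0 _)

theorem IsPositiveMeasure.mono (hS : NormalSeparating E) (hν : IsPositiveMeasure ν)
    {s t : {s : Set X // MeasurableSet s}} (hst : s.1 ⊆ t.1) : ν s ≤ ν t :=
  mono_of_scalar hS hν.nonneg (fun _ hφ => ⟨hν.scalar hφ, inferInstance, hν.real_scalar hφ⟩) hst

/-- Scalar criterion for a set map to be a positive regular Borel measure. -/
theorem IsPositiveRegularBorelMeasure.of_scalar (hE : IsDedekindComplete E)
    (hS : NormalSeparating E) (h0 : ∀ s, 0 ≤ ν s)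
    (h : ∀ φ : E →ₗ[ℝ] ℝ, IsNormalFunctional φ → ∃ m : Measure X, IsFiniteMeasure m ∧ m.Regular ∧
      ∀ s, φ (ν s) = m.real s.1) : IsPositiveRegularBorelMeasure ν := by
  have h' : ∀ φ : E →ₗ[ℝ] ℝ, IsNormalFunctional φ → ∃ m : Measure X, IsFiniteMeasure m ∧
      ∀ s, φ (ν s) = m.real s.1 := fun φ hφ => by
    obtain ⟨m, h1, -, h2⟩ := h φ hφ
    exact ⟨m, h1, h2⟩
  have hmono : ∀ s t : {s : Set X // MeasurableSet s}, s.1 ⊆ t.1 → ν s ≤ ν t :=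
    fun s t => mono_of_scalar hS h0 h'
  refine { IsPositiveMeasure.of_scalar hE hS h0 h' with innerRegular := ?_, outerRegular := ?_ }
  · intro V hV
    refine hS.isLUB_of_scalar hE ⟨_, ∅, isCompact_empty, Set.empty_subset V, rfl⟩ ?_ ?_ ?_
    · rintro _ ⟨K, hK, hKV, rfl⟩ _ ⟨L, hL, hLV, rfl⟩
      exact ⟨_, ⟨K ∪ L, hK.union hL, Set.union_subset hKV hLV, rfl⟩,
        hmono _ _ Set.subset_union_left, hmono _ _ Set.subset_union_right⟩
    · rintro _ ⟨K, hK, hKV, rfl⟩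
      exact hmono _ _ hKV
    · intro φ hφ
      obtain ⟨m, hm, hr, hmν⟩ := h φ hφ
      rw [hmν]
      convert isLUB_measureReal_isCompact m hV using 1
      ext r
      constructor
      · rintro ⟨_, ⟨K, hK, hKV, rfl⟩, rfl⟩
        exact ⟨K, hK, hKV, hmν _⟩
      · rintro ⟨K, hK, hKV, rfl⟩
        exact ⟨_, ⟨K, hK, hKV, rfl⟩, hmν _⟩
  · intro A hA
    refine hS.isGLB_of_scalar hE ⟨_, Set.univ, isOpen_univ, Set.subset_univ A, rfl⟩ ?_ ?_ ?_
    · rintro _ ⟨V, hV, hAV, rfl⟩ _ ⟨W, hW, hAW, rfl⟩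
      exact ⟨_, ⟨V ∩ W, hV.inter hW, Set.subset_inter hAV hAW, rfl⟩,
        hmono _ _ Set.inter_subset_left, hmono _ _ Set.inter_subset_right⟩
    · rintro _ ⟨V, hV, hAV, rfl⟩
      exact hmono _ _ hAV
    · intro φ hφ
      obtain ⟨m, hm, hr, hmν⟩ := h φ hφ
      rw [hmν]
      convert isGLB_measureReal_isOpen m A using 1
      ext r
      constructor
      · rintro ⟨_, ⟨V, hV, hAV, rfl⟩, rfl⟩
        exact ⟨V, hV, hAV, hmν _⟩
      · rintro ⟨V, hV, hAV, rfl⟩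
        exact ⟨_, ⟨V, hV, hAV, rfl⟩, hmν _⟩

/-- Values on compact subsets are directed upwards by unions, values on open supersets downwards by
intersections, so a normal functional preserves the supremum and infimum that define regularity. -/
theorem IsPositiveRegularBorelMeasure.regular_scalar (hS : NormalSeparating E)
    (hν : IsPositiveRegularBorelMeasure ν) (hφ : IsNormalFunctional φ) :
    (hν.toIsPositiveMeasure.scalar hφ).Regular := by
  have hν' := hν.toIsPositiveMeasure
  have houter : (hν'.scalar hφ).OuterRegular := by
    refine ⟨fun A hA r hr => ?_⟩
    -- Since `r` may be infinite, a finite `q` is inserted before passing to real numbers.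
    obtain ⟨q, hq1, hq2⟩ := ENNReal.lt_iff_exists_nnreal_btwn.1 hr
    rw [hν'.scalar_apply hφ hA, ← ENNReal.ofReal_coe_nnreal, ENNReal.ofReal_lt_ofReal_iff'] at hq1
    have hglb := hφ.isGLB (D := {a | ∃ (V : Set X) (hV : IsOpen V), A ⊆ V ∧
        a = ν ⟨V, hV.measurableSet⟩}) ⟨_, Set.univ, isOpen_univ, Set.subset_univ A, rfl⟩ (by
      rintro _ ⟨V, hV, hAV, rfl⟩ _ ⟨W, hW, hAW, rfl⟩
      exact ⟨_, ⟨V ∩ W, hV.inter hW, Set.subset_inter hAV hAW, rfl⟩,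
        hν'.mono hS Set.inter_subset_left, hν'.mono hS Set.inter_subset_right⟩)
      (hν.outerRegular A hA)
    obtain ⟨_, ⟨_, ⟨V, hV, hAV, rfl⟩, rfl⟩, -, hlt⟩ := hglb.exists_between hq1.1
    refine ⟨V, hAV, hV, lt_of_le_of_lt ?_ hq2⟩
    rw [hν'.scalar_apply hφ hV.measurableSet, ← ENNReal.ofReal_coe_nnreal]
    exact ENNReal.ofReal_le_ofReal hlt.le
  refine { houter with lt_top_of_isCompact := fun K _ => measure_lt_top _ _, innerRegular := ?_ }
  intro V hV r hr
  have hrt : r ≠ ⊤ := hr.ne_top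
  rw [hν'.scalar_apply hφ hV.measurableSet, ENNReal.lt_ofReal_iff_toReal_lt hrt] at hr
  have hlub := hφ.isLUB {a | ∃ (K : Set X) (hK : IsCompact K), K ⊆ V ∧
      a = ν ⟨K, hK.measurableSet⟩} _ ⟨_, ∅, isCompact_empty, Set.empty_subset V, rfl⟩ (by
    rintro _ ⟨K, hK, hKV, rfl⟩ _ ⟨L, hL, hLV, rfl⟩
    exact ⟨_, ⟨K ∪ L, hK.union hL, Set.union_subset hKV hLV, rfl⟩,
        hν'.mono hS Set.subset_union_left, hν'.mono hS Set.subset_union_right⟩)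
    (hν.innerRegular V hV)
  obtain ⟨_, ⟨_, ⟨K, hK, hKV, rfl⟩, rfl⟩, hlt, -⟩ := hlub.exists_between hr
  refine ⟨K, hKV, hK, ?_⟩
  rwa [hν'.scalar_apply hφ hK.measurableSet, ENNReal.lt_ofReal_iff_toReal_lt hrt]

theorem IsPositiveRegularBorelMeasure.add (hE : IsDedekindComplete E) (hS : NormalSeparating E)
    (h₁ : IsPositiveRegularBorelMeasure ν₁) (h₂ : IsPositiveRegularBorelMeasure ν₂) :
    IsPositiveRegularBorelMeasure (ν₁ + ν₂) := by
  refine .of_scalar hE hS (fun s => add_nonneg (h₁.nonneg s) (h₂.nonneg s)) fun φ hφ => ?_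
  have := h₁.regular_scalar hS hφ
  have := h₂.regular_scalar hS hφ
  refine ⟨h₁.scalar hφ + h₂.scalar hφ, inferInstance, inferInstance, fun s => ?_⟩
  rw [measureReal_add_apply, ← h₁.real_scalar hφ, ← h₂.real_scalar hφ, ← map_add]
  rfl

theorem IsPositiveRegularBorelMeasure.smul (hE : IsDedekindComplete E) (hS : NormalSeparating E)
    (hν : IsPositiveRegularBorelMeasure ν) {c : ℝ} (hc : 0 ≤ c) :
    IsPositiveRegularBorelMeasure (c • ν) := by
  refine .of_scalar hE hS (fun s => smul_nonneg hc (hν.nonneg s)) fun φ hφ => ?_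
  have := hν.regular_scalar hS hφ
  lift c to ℝ≥0 using hc
  refine ⟨c • hν.scalar hφ, inferInstance, Measure.Regular.smul_nnreal c, fun s => ?_⟩
  rw [measureReal_nnreal_smul_apply, ← hν.real_scalar hφ, ← smul_eq_mul, ← map_smul]
  rfl

theorem isPositiveRegularBorelMeasure_zero (hE : IsDedekindComplete E) (hS : NormalSeparating E) :
    IsPositiveRegularBorelMeasure (0 : {s : Set X // MeasurableSet s} → E) :=
  .of_scalar hE hS (fun _ => le_rfl) fun φ _ =>
    ⟨0, inferInstance, inferInstance, fun _ => by simp⟩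

/-- Every `E`-valued regular Borel measure is a difference of positive ones. -/
theorem RegularBorelMeasures.exists_eq_sub (hE : IsDedekindComplete E) (hS : NormalSeparating E)
    (μ : RegularBorelMeasures X E) : ∃ ν₁ ν₂ : {s : Set X // MeasurableSet s} → E,
      IsPositiveRegularBorelMeasure ν₁ ∧ IsPositiveRegularBorelMeasure ν₂ ∧ μ.1 = ν₁ - ν₂ := by
  obtain ⟨μ, hμ⟩ := μ
  have hz := isPositiveRegularBorelMeasure_zero (X := X) hE hS
  induction hμ using Submodule.span_induction with
  | mem ν hν => exact ⟨ν, 0, hν, hz, (sub_zero ν).symm⟩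
  | zero => exact ⟨0, 0, hz, hz, (sub_zero _).symm⟩
  | add x y _ _ hx hy =>
    obtain ⟨a, b, ha, hb, hab⟩ := hx
    obtain ⟨c, d, hc, hd, hcd⟩ := hy
    refine ⟨a + c, b + d, ha.add hE hS hc, hb.add hE hS hd, ?_⟩
    change x = a - b at hab
    change y = c - d at hcd
    change x + y = _
    rw [hab, hcd]
    abel
  | smul r x _ hx =>
    obtain ⟨a, b, ha, hb, hab⟩ := hx
    change x = a - b at hab
    rcases le_total 0 r with hr | hr
    · exact ⟨r • a, r • b, ha.smul hE hS hr, hb.smul hE hS hr, by rw [← smul_sub, ← hab]⟩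
    · refine ⟨(-r) • b, (-r) • a, hb.smul hE hS (neg_nonneg.2 hr),
        ha.smul hE hS (neg_nonneg.2 hr), ?_⟩
      rw [← smul_sub, ← neg_sub a b, ← hab, neg_smul, smul_neg, neg_neg]

/-- A positive element of the space of regular Borel measures is a positive measure. -/
theorem RegularBorelMeasures.isPositiveRegularBorelMeasure (hE : IsDedekindComplete E)
    (hS : NormalSeparating E) {μ : RegularBorelMeasures X E} (hμ : 0 ≤ μ) :
    IsPositiveRegularBorelMeasure μ.1 := by
  obtain ⟨ν₁, ν₂, h₁, h₂, h⟩ := exists_eq_sub hE hS μ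
  have hμ0 : ∀ s, 0 ≤ μ.1 s := hμ
  refine .of_scalar hE hS hμ0 fun φ hφ => ?_
  have r₁ := h₁.regular_scalar hS hφ
  have r₂ := h₂.regular_scalar hS hφ
  have hreal : ∀ s : {s : Set X // MeasurableSet s},
      φ (μ.1 s) = (h₁.scalar hφ).real s.1 - (h₂.scalar hφ).real s.1 := fun s => by
    rw [← h₁.real_scalar hφ, ← h₂.real_scalar hφ, ← map_sub, h]
    rfl
  -- Positivity of `μ` orders the two scalar measures, so their difference is a measure. It lies
  -- below a regular one and is thus regular.
  have hle : h₂.scalar hφ ≤ h₁.scalar hφ := by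
    refine Measure.le_iff.2 fun s hs => ?_
    rw [← ENNReal.toReal_le_toReal (measure_ne_top _ _) (measure_ne_top _ _)]
    have := hreal ⟨s, hs⟩
    have h3 := hφ.pos _ (hμ0 ⟨s, hs⟩)
    rw [this] at h3
    exact sub_nonneg.1 h3
  have hfin : IsFiniteMeasure (h₁.scalar hφ - h₂.scalar hφ) := inferInstance
  have hsub : ∀ s : {s : Set X // MeasurableSet s},
      φ (μ.1 s) = (h₁.scalar hφ - h₂.scalar hφ).real s.1 := fun s => by
    rw [hreal, measureReal_def (h₁.scalar hφ - h₂.scalar hφ), Measure.sub_apply s.2 hle,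
      ENNReal.toReal_sub_of_le (hle _) (measure_ne_top _ _)]
    rfl
  refine ⟨_, hfin, ?_, hsub⟩
  exact regular_of_le Measure.sub_le

variable [LocallyCompactSpace X]

/-- Every positive operator from `C₀(X)` to a quasi-perfect vector lattice is represented by a
positive regular Borel measure. -/
theorem exists_positive_measure_of_isPositiveOperator (hQ : IsQuasiPerfect E)
    {S : C₀(X, ℝ) →ₗ[ℝ] E} (hpos : IsPositiveOperator S) :
    ∃ (ν : {s : Set X // MeasurableSet s} → E) (hν : IsPositiveRegularBorelMeasure ν),
      ∀ (φ : E →ₗ[ℝ] ℝ) (hφ : IsNormalFunctional φ) (f : C₀(X, ℝ)),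
        φ (S f) = ∫ x, f x ∂(hν.toIsPositiveMeasure.scalar hφ) := by
  have hE := hQ.isDedekindComplete
  have hS := hQ.normalSeparating
  -- The candidate for the measure of an open `V` is the supremum of `D V`.
  set D : Set X → Set E := fun V =>
    {a | ∃ f : C₀(X, ℝ), 0 ≤ f ∧ (∀ x ∉ V, f x = 0) ∧ (∀ x, f x ≤ 1) ∧ a = S f} with hD
  have hne : ∀ V, (D V).Nonempty := fun V => ⟨_, 0, le_rfl, fun _ _ => rfl, fun _ => zero_le_one,
    rfl⟩
  have hdir : ∀ V, DirectedOn (· ≤ ·) (D V) := by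
    rintro V _ ⟨f, hf0, hfV, hf1, rfl⟩ _ ⟨g, hg0, hgV, hg1, rfl⟩
    refine ⟨_, ⟨f ⊔ g, hf0.trans le_sup_left, fun x hx => ?_, fun x => sup_le (hf1 x) (hg1 x),
      rfl⟩, hpos.mono le_sup_left, hpos.mono le_sup_right⟩
    rw [ZeroAtInftyContinuousMap.sup_apply, hfV x hx, hgV x hx, sup_idem]
  have hlub : ∀ V, ∃ a, IsLUB (D V) a := fun V => by
    refine hQ.exists_isLUB (D V) (hne V) (hdir V) ?_ fun φ hφ => ?_
    · rintro _ ⟨f, hf0, -, -, rfl⟩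
      exact hpos f hf0
    -- Dedekind completeness does not suffice here: the constant `1` need not be in `C₀(X)`, so `D
    -- V` has no evident upper bound. The positive functional `φ ∘ S` is automatically bounded on
    -- the unit ball, which is what quasi-perfectness asks for.
    · obtain ⟨C, hC0, hC⟩ := IsPositiveOperator.exists_bound (T := φ ∘ₗ S)
        fun f hf => hφ _ (hpos f hf)
      refine ⟨C, ?_⟩
      rintro _ ⟨_, ⟨f, hf0, -, hf1, rfl⟩, rfl⟩
      refine (le_abs_self _).trans ((hC f).trans (mul_le_of_le_one_right hC0 ?_))
      exact f.norm_le_of_forall zero_le_one fun x => by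
        rw [abs_of_nonneg (hf0 x)]
        exact hf1 x
  choose a ha using hlub
  have hamono : ∀ V W : Set X, V ⊆ W → a V ≤ a W := fun V W hVW => by
    refine (ha V).mono (ha W) ?_
    rintro _ ⟨f, hf0, hfV, hf1, rfl⟩
    exact ⟨f, hf0, fun x hx => hfV x fun h => hx (hVW h), hf1, rfl⟩
  have ha0 : ∀ V, 0 ≤ a V := fun V =>
    (ha V).1 ⟨0, le_rfl, fun _ _ => rfl, fun _ => zero_le_one, (map_zero S).symm⟩
  have hmeas : ∀ (φ : E →ₗ[ℝ] ℝ), IsNormalFunctional φ → ∃ m : Measure X, IsFiniteMeasure m ∧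
      m.Regular ∧ ∀ f : C₀(X, ℝ), φ (S f) = ∫ x, f x ∂m := fun φ hφ =>
    exists_regular_measure_of_isPositiveOperator (Λ := φ ∘ₗ S) fun f hf => hφ.pos _ (hpos f hf)
  choose! m hfin hreg hint using hmeas
  -- One inequality holds because `f` is below the indicator of `V`, the other by Urysohn functions
  -- and inner regularity of `m φ`.
  have haV : ∀ φ, IsNormalFunctional φ → ∀ V, IsOpen V → φ (a V) = (m φ).real V := by
    intro φ hφ V hV
    have := hfin φ hφ
    have := hreg φ hφ
    refine (hφ.isLUB _ _ (hne V) (hdir V) (ha V)).unique ⟨?_, fun b hb => ?_⟩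
    · rintro _ ⟨_, ⟨f, hf0, hfV, hf1, rfl⟩, rfl⟩
      rw [hint φ hφ, ← integral_indicator_one hV.measurableSet]
      refine integral_mono (f.integrable _)
        ((integrable_const (1 : ℝ)).indicator hV.measurableSet) fun x => ?_
      by_cases hx : x ∈ V
      · simpa [hx] using hf1 x
      · simp [hx, hfV x hx]
    · refine (isLUB_measureReal_isCompact (m φ) hV).2 ?_
      rintro _ ⟨K, hK, hKV, rfl⟩
      obtain ⟨f, hf0, hfK, hfV, hf1⟩ :=
        ZeroAtInftyContinuousMap.exists_eq_one_of_isCompact hK hV hKV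
      refine le_trans ?_ (hb ⟨_, ⟨f, hf0, hfV, hf1, rfl⟩, rfl⟩)
      rw [hint φ hφ, ← integral_indicator_one hK.measurableSet]
      refine integral_mono ((integrable_const (1 : ℝ)).indicator hK.measurableSet)
        (f.integrable _) fun x => ?_
      by_cases hx : x ∈ K
      · simp [hx, hfK x hx]
      · simpa [hx] using hf0 x
  set G : {s : Set X // MeasurableSet s} → Set E := fun A =>
    {b | ∃ V, IsOpen V ∧ A.1 ⊆ V ∧ b = a V} with hG
  have hGne : ∀ A, (G A).Nonempty := fun A =>
    ⟨_, Set.univ, isOpen_univ, Set.subset_univ _, rfl⟩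
  have hG0 : ∀ A, (0 : E) ∈ lowerBounds (G A) := by
    rintro A _ ⟨V, -, -, rfl⟩
    exact ha0 V
  have hglb : ∀ A, ∃ b, IsGLB (G A) b := fun A => hE.exists_isGLB (hGne A) ⟨0, hG0 A⟩
  choose ν hν using hglb
  -- The values on open supersets are directed downwards, so `φ` commutes with their infimum, and
  -- outer regularity of `m φ` identifies the result.
  have hreal : ∀ φ, IsNormalFunctional φ → ∀ A, φ (ν A) = (m φ).real A.1 := by
    intro φ hφ A
    have := hfin φ hφ
    have := hreg φ hφ
    have h1 := hφ.isGLB (hGne A) (by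
      rintro _ ⟨V, hV, hAV, rfl⟩ _ ⟨W, hW, hAW, rfl⟩
      exact ⟨_, ⟨V ∩ W, hV.inter hW, Set.subset_inter hAV hAW, rfl⟩,
        hamono _ _ Set.inter_subset_left, hamono _ _ Set.inter_subset_right⟩) (hν A)
    have e : φ '' G A = {r | ∃ V, IsOpen V ∧ A.1 ⊆ V ∧ r = (m φ).real V} := by
      ext r
      constructor
      · rintro ⟨_, ⟨V, hV, hAV, rfl⟩, rfl⟩
        exact ⟨V, hV, hAV, haV φ hφ V hV⟩
      · rintro ⟨V, hV, hAV, rfl⟩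
        exact ⟨_, ⟨V, hV, hAV, rfl⟩, haV φ hφ V hV⟩
    rw [e] at h1
    exact h1.unique (isGLB_measureReal_isOpen (m φ) A.1)
  have hνreg : IsPositiveRegularBorelMeasure ν :=
    .of_scalar hE hS (fun A => (hν A).2 (hG0 A)) fun φ hφ =>
      ⟨m φ, hfin φ hφ, hreg φ hφ, hreal φ hφ⟩
  refine ⟨ν, hνreg, fun φ hφ f => ?_⟩
  have := hfin φ hφ
  have e : hνreg.scalar hφ = m φ := measure_eq_of_measureReal_eq fun s hs => by
    rw [← hreal φ hφ ⟨s, hs⟩, hνreg.real_scalar hφ]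
  rw [hint φ hφ, e]

end RegularMeasures

/-! ### The integration map -/

section IntegrationMap

open MeasureTheory

set_option linter.unusedSectionVars false

variable {X : Type*} [TopologicalSpace X] [T2Space X] [MeasurableSpace X] [BorelSpace X]
  {E : Type*} [AddCommGroup E] [Module ℝ E] [Lattice E] [IsOrderedAddMonoid E]
  [IsOrderedModule ℝ E]
  {ν ν₁ ν₂ ν₃ ν₄ : {s : Set X // MeasurableSet s} → E} {φ : E →ₗ[ℝ] ℝ}

/-- Integration against a positive vector measure is a positive operator on `C₀(X)`. -/
theorem IsPositiveMeasure.exists_operator (hE : IsDedekindComplete E) (hS : NormalSeparating E)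
    (hν : IsPositiveMeasure ν) :
    ∃ T : C₀(X, ℝ) →ₗ[ℝ] E, IsPositiveOperator T ∧ (∀ f : C₀(X, ℝ), HasOrderIntegral ν f (T f)) ∧
      (∀ φ (hφ : IsNormalFunctional φ) f, φ (T f) = ∫ x, f x ∂(hν.scalar hφ)) ∧
      ∀ f : C₀(X, ℝ), 0 ≤ f → (∀ x, f x ≤ 1) → T f ≤ ν ⟨Set.univ, MeasurableSet.univ⟩ := by
  have hpos : ∀ f : C₀(X, ℝ), ∃ a, HasPositiveOrderIntegral ν (fun x => max (f x) 0) a :=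
    fun f => by
      obtain ⟨a, ha, -⟩ := hν.exists_hasPositiveOrderIntegral hE hS
        (f := fun x => max (f x) 0) (Continuous.measurable (by fun_prop))
        (fun x => le_max_right _ _) (C := ‖f‖₊)
        (fun x => max_le ((le_abs_self _).trans (f.abs_apply_le_norm x)) (norm_nonneg _))
      exact ⟨a, ha⟩
  have hex : ∀ f : C₀(X, ℝ), ∃ a, HasOrderIntegral ν f a := fun f => by
    obtain ⟨b, hb⟩ := hpos f
    obtain ⟨c, hc⟩ := hpos (-f)
    exact ⟨b - c, b, c, hb, hc, rfl⟩
  choose T hT using hex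
  -- These scalar values determine `T`, which was chosen pointwise; linearity follows from that of
  -- the Lebesgue integral.
  have hφT : ∀ φ (hφ : IsNormalFunctional φ) f, φ (T f) = ∫ x, f x ∂(hν.scalar hφ) :=
    fun φ hφ f => hν.apply_eq_of_hasOrderIntegral hS hφ (f.integrable _) (hT f)
  have heq : ∀ f : C₀(X, ℝ), 0 ≤ f → ∀ a, HasPositiveOrderIntegral ν f a → T f = a :=
    fun f hf a ha => hS.ext fun φ hφ => by
      rw [hφT φ hφ, hν.apply_eq_of_hasPositiveOrderIntegral hS hφ ha,
        integral_eq_lintegral_of_nonneg_ae (Eventually.of_forall hf)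
          f.continuous.aestronglyMeasurable]
  refine ⟨{ toFun := T, map_add' := fun f g => hS.ext fun φ hφ => ?_,
            map_smul' := fun c f => hS.ext fun φ hφ => ?_ }, fun f hf => ?_, hT, hφT,
            fun f hf h1 => ?_⟩
  · rw [map_add, hφT φ hφ, hφT φ hφ, hφT φ hφ]
    exact integral_add (f.integrable _) (g.integrable _)
  · rw [RingHom.id_apply, map_smul, hφT φ hφ, hφT φ hφ]
    exact integral_const_mul c _
  · obtain ⟨a, ha, ha0, -⟩ := hν.exists_hasPositiveOrderIntegral hE hS f.continuous.measurable
      hf (C := ‖f‖₊) fun x => (le_abs_self _).trans (f.abs_apply_le_norm x)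
    exact ha0.trans_eq (heq f hf a ha).symm
  · obtain ⟨a, ha, -, ha1⟩ := hν.exists_hasPositiveOrderIntegral hE hS f.continuous.measurable
      hf (C := 1) h1
    rw [NNReal.coe_one, one_smul] at ha1
    exact (heq f hf a ha).trans_le ha1

/-- The hypothesis rearranges to `ν₁ + ν₄ = ν₃ + ν₂`, an identity between positive measures that
passes to the scalar measures. -/
theorem IsPositiveMeasure.integral_sub_integral_eq (h₁ : IsPositiveMeasure ν₁)
    (h₂ : IsPositiveMeasure ν₂) (h₃ : IsPositiveMeasure ν₃) (h₄ : IsPositiveMeasure ν₄)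
    (h : ν₁ - ν₂ = ν₃ - ν₄) (hφ : IsNormalFunctional φ) (f : C₀(X, ℝ)) :
    ∫ x, f x ∂(h₁.scalar hφ) - ∫ x, f x ∂(h₂.scalar hφ) =
      ∫ x, f x ∂(h₃.scalar hφ) - ∫ x, f x ∂(h₄.scalar hφ) := by
  have e : h₁.scalar hφ + h₄.scalar hφ = h₃.scalar hφ + h₂.scalar hφ :=
    measure_eq_of_measureReal_eq fun s hs => by
      have h5 := congrArg φ (congrFun h ⟨s, hs⟩)
      rw [Pi.sub_apply, Pi.sub_apply, map_sub, map_sub, h₁.real_scalar hφ, h₂.real_scalar hφ,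
        h₃.real_scalar hφ, h₄.real_scalar hφ] at h5
      rw [measureReal_add_apply, measureReal_add_apply]
      linarith
  rw [sub_eq_sub_iff_add_eq_add, ← integral_add_measure (f.integrable _) (f.integrable _),
    ← integral_add_measure (f.integrable _) (f.integrable _), e]

theorem IsPositiveMeasure.integral_scalar_add (h₁ : IsPositiveMeasure ν₁)
    (h₂ : IsPositiveMeasure ν₂) (h : IsPositiveMeasure (ν₁ + ν₂)) (hφ : IsNormalFunctional φ)
    (f : C₀(X, ℝ)) : ∫ x, f x ∂(h.scalar hφ) =
      ∫ x, f x ∂(h₁.scalar hφ) + ∫ x, f x ∂(h₂.scalar hφ) := by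
  rw [← integral_add_measure (f.integrable _) (f.integrable _)]
  congr 1
  refine measure_eq_of_measureReal_eq fun s hs => ?_
  rw [measureReal_add_apply, ← h.real_scalar hφ ⟨s, hs⟩, ← h₁.real_scalar hφ ⟨s, hs⟩,
    ← h₂.real_scalar hφ ⟨s, hs⟩, ← map_add]
  rfl

theorem IsPositiveMeasure.integral_scalar_smul (hν : IsPositiveMeasure ν) {c : ℝ} (hc : 0 ≤ c)
    (h : IsPositiveMeasure (c • ν)) (hφ : IsNormalFunctional φ)
    (f : C₀(X, ℝ)) : ∫ x, f x ∂(h.scalar hφ) = c * ∫ x, f x ∂(hν.scalar hφ) := by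
  lift c to ℝ≥0 using hc
  have e : h.scalar hφ = c • hν.scalar hφ := measure_eq_of_measureReal_eq fun s hs => by
    rw [measureReal_nnreal_smul_apply, ← hν.real_scalar hφ ⟨s, hs⟩, ← h.real_scalar hφ ⟨s, hs⟩,
      ← smul_eq_mul, ← map_smul]
    rfl
  rw [e, integral_smul_nnreal_measure]
  rfl

theorem IsPositiveMeasure.integral_scalar_zero
    (h : IsPositiveMeasure (0 : {s : Set X // MeasurableSet s} → E)) (hφ : IsNormalFunctional φ)
    (f : C₀(X, ℝ)) : ∫ x, f x ∂(h.scalar hφ) = 0 := by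
  have e : h.scalar hφ = 0 := measure_eq_of_measureReal_eq fun s hs => by
    rw [← h.real_scalar hφ ⟨s, hs⟩]
    simp
  rw [e, integral_zero_measure]

variable [LocallyCompactSpace X]

/-- The integrals of all continuous functions determine the measure. -/
theorem IsPositiveRegularBorelMeasure.eq_of_integral_eq (hS : NormalSeparating E)
    (h₁ : IsPositiveRegularBorelMeasure ν₁) (h₂ : IsPositiveRegularBorelMeasure ν₂)
    (h : ∀ φ (hφ : IsNormalFunctional φ) (f : C₀(X, ℝ)),
      ∫ x, f x ∂(h₁.scalar hφ) = ∫ x, f x ∂(h₂.scalar hφ)) : ν₁ = ν₂ :=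
  funext fun s => hS.ext fun φ hφ => by
    have := h₁.regular_scalar hS hφ
    have := h₂.regular_scalar hS hφ
    rw [h₁.real_scalar hφ, h₂.real_scalar hφ,
      measure_eq_of_integral_zeroAtInfty_eq (h φ hφ)]

/-- The Riesz representation theorem for regular operators from `C₀(X)` to a quasi-perfect vector
lattice. -/
theorem exists_integrationMap (hQ : IsQuasiPerfect E) :
    ∃ I : RegularBorelMeasures X E ≃ₗ[ℝ] RegularOperators C₀(X, ℝ) E,
      IsIntegrationMap I ∧ ∀ μ μ', I μ ≤ I μ' ↔ μ ≤ μ' := by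
  have hE := hQ.isDedekindComplete
  have hS := hQ.normalSeparating
  -- The formula is recorded for every decomposition into positive measures, regular or not: the
  -- definition of the integral allows all of them, and later steps choose convenient ones.
  have key : ∀ μ : RegularBorelMeasures X E, ∃ T : RegularOperators C₀(X, ℝ) E,
      (∀ f : C₀(X, ℝ), HasSignedOrderIntegral μ.1 f (T.1 f)) ∧
      ∀ ν₁ ν₂ (h₁ : IsPositiveMeasure ν₁) (h₂ : IsPositiveMeasure ν₂), μ.1 = ν₁ - ν₂ →
        ∀ φ (hφ : IsNormalFunctional φ) f,
          φ (T.1 f) = ∫ x, f x ∂(h₁.scalar hφ) - ∫ x, f x ∂(h₂.scalar hφ) := by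
    intro μ
    obtain ⟨ν₁, ν₂, h₁, h₂, h⟩ := RegularBorelMeasures.exists_eq_sub hE hS μ
    obtain ⟨T₁, hT₁, hi₁, hφ₁, -⟩ := h₁.exists_operator hE hS
    obtain ⟨T₂, hT₂, hi₂, hφ₂, -⟩ := h₂.exists_operator hE hS
    refine ⟨⟨T₁ - T₂, T₁, T₂, hT₁, hT₂, rfl⟩, fun f => ⟨ν₁, ν₂, h₁.toIsPositiveMeasure,
      h₂.toIsPositiveMeasure, h, _, _, hi₁ f, hi₂ f, rfl⟩, fun ν₃ ν₄ h₃ h₄ h' φ hφ f => ?_⟩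
    change φ (T₁ f - T₂ f) = _
    rw [map_sub, hφ₁ φ hφ, hφ₂ φ hφ]
    exact IsPositiveMeasure.integral_sub_integral_eq _ _ h₃ h₄ (h.symm.trans h') hφ f
  choose I hI hφI using key
  have hext : ∀ S T : RegularOperators C₀(X, ℝ) E,
      (∀ φ, IsNormalFunctional φ → ∀ f, φ (S.1 f) = φ (T.1 f)) → S = T := fun S T h =>
    Subtype.ext (LinearMap.ext fun f => hS.ext fun φ hφ => h φ hφ f)
  have hadd : ∀ μ μ', I (μ + μ') = I μ + I μ' := fun μ μ' => hext _ _ fun φ hφ f => by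
    obtain ⟨a, b, ha, hb, hab⟩ := RegularBorelMeasures.exists_eq_sub hE hS μ
    obtain ⟨c, d, hc, hd, hcd⟩ := RegularBorelMeasures.exists_eq_sub hE hS μ'
    have hac := (ha.add hE hS hc).toIsPositiveMeasure
    have hbd := (hb.add hE hS hd).toIsPositiveMeasure
    change φ _ = φ ((I μ).1 f + (I μ').1 f)
    rw [map_add, hφI μ a b ha.1 hb.1 hab φ hφ, hφI μ' c d hc.1 hd.1 hcd φ hφ,
      hφI (μ + μ') _ _ hac hbd (by
        change μ.1 + μ'.1 = _
        rw [hab, hcd]; abel) φ hφ,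
      ha.1.integral_scalar_add hc.1, hb.1.integral_scalar_add hd.1]
    ring
  have hsmul : ∀ (r : ℝ) μ, I (r • μ) = r • I μ := fun r μ => hext _ _ fun φ hφ f => by
    obtain ⟨a, b, ha, hb, hab⟩ := RegularBorelMeasures.exists_eq_sub hE hS μ
    change φ _ = φ (r • (I μ).1 f)
    rw [map_smul, hφI μ a b ha.1 hb.1 hab φ hφ]
    rcases le_total 0 r with hr | hr
    · rw [hφI (r • μ) _ _ (ha.smul hE hS hr).1 (hb.smul hE hS hr).1 (by
          change r • μ.1 = _
          rw [hab, smul_sub]) φ hφ, ha.1.integral_scalar_smul hr, hb.1.integral_scalar_smul hr,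
        smul_eq_mul]
      ring
    · have hr' := neg_nonneg.2 hr
      rw [hφI (r • μ) _ _ (hb.smul hE hS hr').1 (ha.smul hE hS hr').1 (by
          change r • μ.1 = _
          rw [hab, neg_smul, neg_smul, smul_sub]; abel) φ hφ,
        ha.1.integral_scalar_smul hr', hb.1.integral_scalar_smul hr', smul_eq_mul]
      ring
  have hinj : ∀ μ, I μ = 0 → μ = 0 := fun μ h => by
    obtain ⟨a, b, ha, hb, hab⟩ := RegularBorelMeasures.exists_eq_sub hE hS μ
    apply Subtype.ext
    rw [hab, ha.eq_of_integral_eq hS hb fun φ hφ f => ?_, sub_self]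
    · rfl
    · rw [← sub_eq_zero, ← hφI μ a b ha.1 hb.1 hab φ hφ, h]
      exact map_zero φ
  have hpos : ∀ T : RegularOperators C₀(X, ℝ) E, 0 ≤ T → ∃ μ, 0 ≤ μ ∧ I μ = T := fun T hT => by
    obtain ⟨ν, hν, h⟩ := exists_positive_measure_of_isPositiveOperator hQ
      (RegularOperators.nonneg_iff.1 hT)
    have hz := isPositiveRegularBorelMeasure_zero (X := X) hE hS
    let μ : RegularBorelMeasures X E := ⟨ν, Submodule.subset_span hν⟩
    refine ⟨μ, hν.nonneg, hext _ _ fun φ hφ f => ?_⟩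
    rw [hφI μ ν 0 hν.1 hz.1 (sub_zero ν).symm φ hφ, h φ hφ,
      IsPositiveMeasure.integral_scalar_zero, sub_zero]
  let L : RegularBorelMeasures X E →ₗ[ℝ] RegularOperators C₀(X, ℝ) E :=
    { toFun := I, map_add' := hadd, map_smul' := hsmul }
  have hLinj : Function.Injective L := (injective_iff_map_eq_zero L).2 hinj
  have hLsurj : Function.Surjective L := fun T => by
    obtain ⟨S, R, hSp, hRp, hT⟩ := T.2
    obtain ⟨μ, -, hμ⟩ := hpos hSp.regular hSp
    obtain ⟨μ', -, hμ'⟩ := hpos hRp.regular hRp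
    refine ⟨μ - μ', ?_⟩
    rw [map_sub]
    change I μ - I μ' = T
    rw [hμ, hμ']
    exact Subtype.ext hT.symm
  -- If the operator is positive, some positive measure represents it, and injectivity identifies
  -- that measure with `μ`.
  have hnonneg : ∀ μ, 0 ≤ L μ ↔ 0 ≤ μ := fun μ => by
    constructor
    · intro h
      obtain ⟨μ', hμ', he⟩ := hpos _ h
      rwa [← hLinj he]
    · intro h f hf
      have hμ := RegularBorelMeasures.isPositiveRegularBorelMeasure hE hS h
      have hz := isPositiveRegularBorelMeasure_zero (X := X) hE hS
      obtain ⟨T, hT, -, hφT, -⟩ := hμ.exists_operator hE hS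
      have e : (I μ).1 f = T f := hS.ext fun φ hφ => by
        rw [hφI μ _ 0 hμ.1 hz.1 (sub_zero _).symm φ hφ, hφT φ hφ,
          IsPositiveMeasure.integral_scalar_zero, sub_zero]
      change 0 ≤ (I μ).1 f
      rw [e]
      exact hT f hf
  refine ⟨LinearEquiv.ofBijective L ⟨hLinj, hLsurj⟩, fun μ f a => ⟨?_, ?_⟩, fun μ μ' => ?_⟩
  · rintro ⟨ν₁, ν₂, h₁, h₂, h, a₁, a₂, ha₁, ha₂, rfl⟩
    refine hS.ext fun φ hφ => ?_
    change _ = φ ((I μ).1 f)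
    rw [hφI μ ν₁ ν₂ h₁ h₂ h φ hφ, map_sub,
      h₁.apply_eq_of_hasOrderIntegral hS hφ (f.integrable _) ha₁,
      h₂.apply_eq_of_hasOrderIntegral hS hφ (f.integrable _) ha₂]
  · rintro rfl
    exact hI μ f
  · change L μ ≤ L μ' ↔ _
    have h := hnonneg (μ' - μ)
    rwa [map_sub, sub_nonneg, sub_nonneg] at h

theorem IsIntegrationMap.apply_eq {I : RegularBorelMeasures X E ≃ₗ[ℝ] RegularOperators C₀(X, ℝ) E}
    (hI : IsIntegrationMap I) (hE : IsDedekindComplete E) (hS : NormalSeparating E)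
    {μ : RegularBorelMeasures X E} (hμ : IsPositiveRegularBorelMeasure μ.1) {f : C₀(X, ℝ)} {a : E}
    (ha : HasOrderIntegral μ.1 f a) : (I μ).1 f = a := by
  have hz := isPositiveRegularBorelMeasure_zero (X := X) hE hS
  obtain ⟨T, -, hT, hφT, -⟩ := hz.exists_operator hE hS
  have h0 : T f = 0 := hS _ fun φ hφ => by
    rw [hφT φ hφ, IsPositiveMeasure.integral_scalar_zero]
  exact ((hI μ f a).1 ⟨μ.1, 0, hμ.1, hz.1, (sub_zero _).symm, a, _, ha, hT f,
    by rw [h0, sub_zero]⟩).symm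

/-- The total mass of a positive measure is the supremum of the integrals of the functions in the
positive unit ball. -/
theorem IsIntegrationMap.isLUB_univ
    {I : RegularBorelMeasures X E ≃ₗ[ℝ] RegularOperators C₀(X, ℝ) E}
    (hI : IsIntegrationMap I) (hE : IsDedekindComplete E) (hS : NormalSeparating E)
    {μ : RegularBorelMeasures X E} (hμ : IsPositiveRegularBorelMeasure μ.1) :
    IsLUB {a | ∃ f : C₀(X, ℝ), 0 ≤ f ∧ (∀ x, f x ≤ 1) ∧ a = (I μ).1 f}
      (μ.1 ⟨Set.univ, MeasurableSet.univ⟩) := by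
  obtain ⟨T, hT, hi, hφT, hle⟩ := hμ.exists_operator hE hS
  have e : ∀ f, (I μ).1 f = T f := fun f => hI.apply_eq hE hS hμ (hi f)
  simp only [e]
  refine hS.isLUB_of_scalar hE ⟨_, 0, le_rfl, fun _ => zero_le_one, rfl⟩ ?_ ?_ fun φ hφ => ?_
  · rintro _ ⟨f, hf0, hf1, rfl⟩ _ ⟨g, hg0, hg1, rfl⟩
    exact ⟨_, ⟨f ⊔ g, hf0.trans le_sup_left, fun x => sup_le (hf1 x) (hg1 x), rfl⟩,
      hT.mono le_sup_left, hT.mono le_sup_right⟩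
  · rintro _ ⟨f, hf0, hf1, rfl⟩
    exact hle f hf0 hf1
  · refine ⟨?_, fun b hb => ?_⟩
    · rintro _ ⟨_, ⟨f, hf0, hf1, rfl⟩, rfl⟩
      exact hφ.pos.mono (hle f hf0 hf1)
    · have := hμ.regular_scalar hS hφ
      rw [hμ.real_scalar hφ]
      refine (isLUB_measureReal_isCompact _ isOpen_univ).2 ?_
      -- By inner regularity of the scalar measure at `X`, it is enough to dominate indicators of
      -- compact sets by Urysohn functions.
      rintro _ ⟨K, hK, -, rfl⟩
      obtain ⟨f, hf0, hfK, -, hf1⟩ :=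
        ZeroAtInftyContinuousMap.exists_eq_one_of_isCompact hK isOpen_univ (Set.subset_univ K)
      refine le_trans ?_ (hb ⟨_, ⟨f, hf0, hf1, rfl⟩, rfl⟩)
      rw [hφT φ hφ, ← integral_indicator_one hK.measurableSet]
      refine integral_mono ((integrable_const (1 : ℝ)).indicator hK.measurableSet)
        (f.integrable _) fun x => ?_
      by_cases hx : x ∈ K
      · simp [hx, hfK x hx]
      · simpa [hx] using hf0 x

end IntegrationMap

/-! ### Completeness of the regular norm -/

section RegularNorm

set_option linter.unusedSectionVars false

variable {F E : Type*}
  [NormedAddCommGroup F] [NormedSpace ℝ F] [CompleteSpace F] [Lattice F] [IsOrderedAddMonoid F]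
  [IsOrderedModule ℝ F] [HasSolidNorm F]
  [NormedAddCommGroup E] [NormedSpace ℝ E] [Lattice E] [IsOrderedAddMonoid E]
  [IsOrderedModule ℝ E] [HasSolidNorm E]

theorem RegularOperators.continuous (T : RegularOperators F E) : Continuous T.1 := by
  obtain ⟨S, R, hS, hR, hT⟩ := T.2
  obtain ⟨C, -, hC⟩ := hS.exists_bound
  obtain ⟨C', -, hC'⟩ := hR.exists_bound
  rw [hT]
  exact (AddMonoidHomClass.continuous_of_bound S C hC).sub
    (AddMonoidHomClass.continuous_of_bound R C' hC')

theorem RegularOperators.bddAbove_modulus (hL : IsVectorLattice (RegularOperators F E))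
    (T : RegularOperators F E) :
    BddAbove {c | ∃ x : F, ‖x‖ ≤ 1 ∧ c = ‖(modulus T).1 x‖} := by
  obtain ⟨C, hC0, hC⟩ := IsPositiveOperator.exists_bound (T := (modulus T).1) (hL.modulus_nonneg T)
  refine ⟨C, ?_⟩
  rintro _ ⟨x, hx, rfl⟩
  exact (hC x).trans (mul_le_of_le_one_right hC0 hx)

theorem regularNorm_nonneg (T : RegularOperators F E) : 0 ≤ regularNorm T :=
  Real.sSup_nonneg (by rintro _ ⟨x, -, rfl⟩; exact norm_nonneg _)

theorem norm_modulus_apply_le_of_norm_le_one (hL : IsVectorLattice (RegularOperators F E))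
    (T : RegularOperators F E) {x : F} (hx : ‖x‖ ≤ 1) : ‖(modulus T).1 x‖ ≤ regularNorm T :=
  le_csSup (RegularOperators.bddAbove_modulus hL T) ⟨x, hx, rfl⟩

theorem norm_modulus_apply_le (hL : IsVectorLattice (RegularOperators F E))
    (T : RegularOperators F E) (x : F) : ‖(modulus T).1 x‖ ≤ regularNorm T * ‖x‖ := by
  rcases eq_or_ne x 0 with rfl | hx
  · simp
  · have hx' : 0 < ‖x‖ := norm_pos_iff.2 hx
    have h := norm_modulus_apply_le_of_norm_le_one hL T (x := ‖x‖⁻¹ • x) (by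
      rw [norm_smul, norm_inv, norm_norm, inv_mul_cancel₀ hx'.ne'])
    rw [map_smul, norm_smul, norm_inv, norm_norm, inv_mul_le_iff₀ hx'] at h
    rwa [mul_comm]

/-- The factor `2` comes from splitting `x` into its positive and negative parts. It is harmless, as
the estimate only serves to prove summability. -/
theorem norm_apply_le_norm_apply {S T : RegularOperators F E} (h₁ : S ≤ T) (h₂ : -S ≤ T) (x : F) :
    ‖S.1 x‖ ≤ 2 * ‖T.1 |x|‖ := by
  have key : ∀ u, 0 ≤ u → |S.1 u| ≤ T.1 u := fun u hu => abs_le'.2 ⟨h₁ u hu, h₂ u hu⟩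
  have hT : ∀ u, 0 ≤ u → 0 ≤ T.1 u := fun u hu => (abs_nonneg _).trans (key u hu)
  have hle : ∀ u, 0 ≤ u → u ≤ |x| → ‖S.1 u‖ ≤ ‖T.1 |x|‖ := fun u hu hux => by
    refine norm_le_norm_of_abs_le_abs ((key u hu).trans (le_trans ?_ (le_abs_self _)))
    exact IsPositiveOperator.mono (T := T.1) hT hux
  have e : S.1 x = S.1 x⁺ - S.1 x⁻ := by rw [← map_sub, posPart_sub_negPart]
  rw [e, two_mul]
  refine (norm_sub_le _ _).trans (add_le_add (hle _ (posPart_nonneg x) ?_)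
    (hle _ (negPart_nonneg x) ?_))
  · exact sup_le (le_abs_self x) (abs_nonneg x)
  · exact sup_le (neg_le_abs x) (abs_nonneg x)

/-- Any `R` above `T` and `-T` can replace the modulus, since `|(modulus T) x| ≤ R |x|`; only
positive `x` then matter. -/
theorem regularNorm_le (hL : IsVectorLattice (RegularOperators F E))
    {T R : RegularOperators F E} (h₁ : T ≤ R) (h₂ : -T ≤ R) {C : ℝ}
    (hC : ∀ x, 0 ≤ x → ‖x‖ ≤ 1 → ‖R.1 x‖ ≤ C) : regularNorm T ≤ C := by
  refine csSup_le ⟨_, 0, by simp, rfl⟩ ?_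
  rintro _ ⟨x, hx, rfl⟩
  have hpos : IsPositiveOperator (modulus T).1 := hL.modulus_nonneg T
  have h3 : |(modulus T).1 x| ≤ R.1 |x| :=
    (hpos.abs_apply_le x).trans (hL.modulus_le h₁ h₂ _ (abs_nonneg x))
  refine (norm_le_norm_of_abs_le_abs (h3.trans (le_abs_self _))).trans
    (hC _ (abs_nonneg x) ?_)
  rwa [norm_abs_eq_norm]

theorem regularNorm_le_of_bound (hL : IsVectorLattice (RegularOperators F E))
    {T R : RegularOperators F E} (h₁ : T ≤ R) (h₂ : -T ≤ R) {C : ℝ} (hC0 : 0 ≤ C)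
    (hC : ∀ x, 0 ≤ x → ‖R.1 x‖ ≤ C * ‖x‖) : regularNorm T ≤ C :=
  regularNorm_le hL h₁ h₂ fun x hx hx1 => (hC x hx).trans (mul_le_of_le_one_right hC0 hx1)

theorem regularNorm_add_le (hL : IsVectorLattice (RegularOperators F E))
    (S T : RegularOperators F E) : regularNorm (S + T) ≤ regularNorm S + regularNorm T := by
  refine regularNorm_le_of_bound hL (R := modulus S + modulus T)
    (add_le_add (hL.le_modulus S) (hL.le_modulus T)) ?_
    (add_nonneg (regularNorm_nonneg S) (regularNorm_nonneg T)) fun x _ => ?_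
  · rw [neg_add]
    exact add_le_add (hL.neg_le_modulus S) (hL.neg_le_modulus T)
  · rw [add_mul]
    exact (norm_add_le _ _).trans
      (add_le_add (norm_modulus_apply_le hL S x) (norm_modulus_apply_le hL T x))

theorem regularNorm_smul_le (hL : IsVectorLattice (RegularOperators F E)) (r : ℝ)
    (T : RegularOperators F E) : regularNorm (r • T) ≤ |r| * regularNorm T := by
  have h : r • T ≤ |r| • modulus T ∧ -(r • T) ≤ |r| • modulus T := by
    rcases le_total 0 r with hr | hr
    · have e : -(r • T) = r • -T := (smul_neg r T).symm
      rw [abs_of_nonneg hr, e]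
      exact ⟨hL.smul_le_smul _ _ _ hr (hL.le_modulus T),
        hL.smul_le_smul _ _ _ hr (hL.neg_le_modulus T)⟩
    · rw [abs_of_nonpos hr]
      have hr' := neg_nonneg.2 hr
      have h1 := hL.smul_le_smul _ _ _ hr' (hL.le_modulus T)
      have h2 := hL.smul_le_smul _ _ _ hr' (hL.neg_le_modulus T)
      rw [neg_smul] at h1
      rw [smul_neg, neg_smul, neg_neg] at h2
      exact ⟨h2, h1⟩
  refine regularNorm_le_of_bound hL h.1 h.2
    (mul_nonneg (abs_nonneg r) (regularNorm_nonneg T)) fun x _ => ?_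
  change ‖|r| • (modulus T).1 x‖ ≤ _
  rw [norm_smul, Real.norm_eq_abs, abs_abs, mul_assoc]
  exact mul_le_mul_of_nonneg_left (norm_modulus_apply_le hL T x) (abs_nonneg r)

theorem regularNorm_smul (hL : IsVectorLattice (RegularOperators F E)) (r : ℝ)
    (T : RegularOperators F E) : regularNorm (r • T) = |r| * regularNorm T := by
  refine (regularNorm_smul_le hL r T).antisymm ?_
  rcases eq_or_ne r 0 with rfl | hr
  · rw [abs_zero, zero_mul]
    exact regularNorm_nonneg _
  · have h := regularNorm_smul_le hL r⁻¹ (r • T)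
    rw [inv_smul_smul₀ hr, abs_inv] at h
    rwa [← le_inv_mul_iff₀ (abs_pos.2 hr)]

theorem eq_zero_of_regularNorm_eq_zero (hL : IsVectorLattice (RegularOperators F E))
    {T : RegularOperators F E} (h : regularNorm T = 0) : T = 0 := by
  have h0 : ∀ x, (modulus T).1 x = 0 := fun x => by
    have := norm_modulus_apply_le hL T x
    rw [h, zero_mul] at this
    exact norm_le_zero_iff.1 this
  refine le_antisymm (fun x hx => ?_) (fun x hx => ?_)
  · exact (hL.le_modulus T x hx).trans_eq (h0 x)
  · have h1 : -(T.1 x) ≤ 0 := (hL.neg_le_modulus T x hx).trans_eq (h0 x)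
    exact neg_nonpos.1 h1

theorem exists_hasSum_operator [CompleteSpace E] {S : ℕ → RegularOperators F E}
    (h0 : ∀ n, 0 ≤ S n) {c : ℕ → ℝ} (hc : Summable c) (h : ∀ n x, ‖(S n).1 x‖ ≤ c n * ‖x‖) :
    ∃ T : RegularOperators F E, ∀ x, HasSum (fun n => (S n).1 x) (T.1 x) := by
  have hs : ∀ x, Summable fun n => (S n).1 x := fun x =>
    Summable.of_norm_bounded (hc.mul_right ‖x‖) fun n => h n x
  let T : F →ₗ[ℝ] E :=
    { toFun := fun x => ∑' n, (S n).1 x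
      map_add' := fun x y => by simp only [map_add]; exact (hs x).tsum_add (hs y)
      map_smul' := fun r x => by
        simp only [map_smul, RingHom.id_apply]; exact (hs x).tsum_const_smul r }
  have hT : IsPositiveOperator T := fun x hx => tsum_nonneg fun n => h0 n x hx
  exact ⟨hT.regular, fun x => (hs x).hasSum⟩

/-- Summing the positive operators `|u n|` and `|u n| - u n` separately shows that the pointwise sum
of `u` is regular. Its remainders are dominated by those of the sum of `|u n|`, whose norms are at
most the tails of the given series. -/
theorem exists_tendsto_regularNorm_of_summable [CompleteSpace E]
    (hL : IsVectorLattice (RegularOperators F E)) (u : ℕ → RegularOperators F E)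
    (hu : Summable fun n => regularNorm (u n)) : ∃ T : RegularOperators F E,
      Tendsto (fun n => regularNorm (∑ k ∈ Finset.range n, u k - T)) atTop (𝓝 0) := by
  have hb : ∀ n x, ‖(modulus (u n)).1 x‖ ≤ regularNorm (u n) * ‖x‖ :=
    fun n x => norm_modulus_apply_le hL (u n) x
  obtain ⟨A, hA⟩ := exists_hasSum_operator (fun n => hL.modulus_nonneg (u n)) hu hb
  obtain ⟨B, hB⟩ := exists_hasSum_operator (S := fun n => modulus (u n) - u n)
    -- The constant is `1` for the modulus plus `2` from `norm_apply_le_norm_apply`.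
    (fun n => sub_nonneg.2 (hL.le_modulus (u n))) (hu.mul_left 3) (fun n x => by
      change ‖(modulus (u n)).1 x - (u n).1 x‖ ≤ _
      have h1 := norm_apply_le_norm_apply (hL.le_modulus (u n)) (hL.neg_le_modulus (u n)) x
      have h2 := hb n |x|
      rw [norm_abs_eq_norm] at h2
      have h3 := norm_sub_le ((modulus (u n)).1 x) ((u n).1 x)
      linarith [hb n x])
  have hT : ∀ x, HasSum (fun n => (u n).1 x) ((A - B).1 x) := fun x => by
    have h := (hA x).sub (hB x)
    have e : ∀ n, (modulus (u n)).1 x - (modulus (u n) - u n).1 x = (u n).1 x := fun n =>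
      sub_sub_cancel _ _
    simp only [e] at h
    exact h
  have hsum : ∀ (v : ℕ → RegularOperators F E) n x,
      (∑ k ∈ Finset.range n, v k).1 x = ∑ k ∈ Finset.range n, (v k).1 x := fun v n x => by
    rw [Submodule.coe_sum, LinearMap.sum_apply]
  refine ⟨A - B, squeeze_zero (fun n => regularNorm_nonneg _) (fun n => ?_)
    (tendsto_sum_nat_add fun n => regularNorm (u n))⟩
  have hAn : ∀ x, HasSum (fun k => (modulus (u (k + n))).1 x)
      ((A - ∑ k ∈ Finset.range n, modulus (u k)).1 x) := fun x => by
    have h := (hasSum_nat_add_iff' n).2 (hA x)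
    rw [← hsum (fun k => modulus (u k))] at h
    exact h
  have hTn : ∀ x, HasSum (fun k => (u (k + n)).1 x)
      ((A - B - ∑ k ∈ Finset.range n, u k).1 x) := fun x => by
    have h := (hasSum_nat_add_iff' n).2 (hT x)
    rw [← hsum u] at h
    exact h
  have hu' : Summable fun k => regularNorm (u (k + n)) := (summable_nat_add_iff n).2 hu
  refine regularNorm_le_of_bound hL (R := A - ∑ k ∈ Finset.range n, modulus (u k)) ?_ ?_
    (tsum_nonneg fun k => regularNorm_nonneg _) fun x _ => ?_
  · intro x hx
    rw [← neg_sub]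
    exact hasSum_le (fun k => hL.neg_le_modulus (u (k + n)) x hx) (hTn x).neg (hAn x)
  · intro x hx
    rw [neg_sub]
    exact hasSum_le (fun k => hL.le_modulus (u (k + n)) x hx) (hTn x) (hAn x)
  · rw [← (hAn x).tsum_eq, ← tsum_mul_right]
    exact tsum_of_norm_bounded (hu'.mul_right ‖x‖).hasSum fun k => hb _ x

/-- The regular operators between Banach lattices form a Banach lattice in the regular norm as soon
as they form a vector lattice. -/
theorem RegularOperators.isBanachLattice [CompleteSpace E]
    (hL : IsVectorLattice (RegularOperators F E)) :
    IsBanachLattice (RegularOperators F E) regularNorm where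
  isVectorLattice := hL
  eq_zero_of_norm _ := eq_zero_of_regularNorm_eq_zero hL
  norm_add_le := regularNorm_add_le hL
  norm_smul := regularNorm_smul hL
  solid S T h := regularNorm_le_of_bound hL ((hL.le_modulus S).trans h)
    ((hL.neg_le_modulus S).trans h) (regularNorm_nonneg T) fun x _ => norm_modulus_apply_le hL T x
  complete u hu := by
    -- Packaging the regular norm as a group norm reduces completeness to the convergence of
    -- absolutely convergent series.
    let N : AddGroupNorm (RegularOperators F E) :=
      { toFun := regularNorm
        map_zero' := by
          have := regularNorm_smul hL 0 (0 : RegularOperators F E)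
          rwa [zero_smul, abs_zero, zero_mul] at this
        add_le' := regularNorm_add_le hL
        neg' := fun T => by
          have := regularNorm_smul hL (-1) T
          have e : (-1 : ℝ) • T = -T := neg_one_smul ℝ T
          rwa [e, abs_neg, abs_one, one_mul] at this
        eq_zero_of_map_eq_zero' := fun _ => eq_zero_of_regularNorm_eq_zero hL }
    let _ : NormedAddCommGroup (RegularOperators F E) := N.toNormedAddCommGroup
    have hN : ∀ S T : RegularOperators F E, dist S T = regularNorm (S - T) := fun S T => by
      rw [dist_eq_norm]; rfl
    have : CompleteSpace (RegularOperators F E) :=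
      NormedAddCommGroup.completeSpace_of_summable_imp_tendsto fun v hv => by
        obtain ⟨T, hT⟩ := exists_tendsto_regularNorm_of_summable hL v hv
        refine ⟨T, tendsto_iff_dist_tendsto_zero.2 ?_⟩
        simpa only [hN] using hT
    obtain ⟨T, hT⟩ := cauchySeq_tendsto_of_complete (u := u)
      (Metric.cauchySeq_iff.2 (by simpa only [hN] using hu))
    refine ⟨T, ?_⟩
    have := tendsto_iff_dist_tendsto_zero.1 hT
    simpa only [hN] using this

end RegularNorm

/-! ### The isometry and AL-spaces -/

section Isometry

open MeasureTheory

set_option linter.unusedSectionVars false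

variable {X : Type*} [TopologicalSpace X] [T2Space X] [LocallyCompactSpace X]
  {E : Type*} [NormedAddCommGroup E] [NormedSpace ℝ E] [Lattice E] [IsOrderedAddMonoid E]
  [IsOrderedModule ℝ E] [HasSolidNorm E]

/-- As an order isomorphism, `I` maps `|μ|` to `|I μ|`, so `|μ|(X)` is the supremum of `|I μ| f`
over `0 ≤ f ≤ 1`. Solidity of the norm gives `≤`. In a KB-space this directed supremum is also a
norm limit, so its norm is at most the regular norm. -/
theorem IsKBSpace.regularNorm_eq_measureNorm [MeasurableSpace X] [BorelSpace X] (hE : IsKBSpace E)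
    {I : RegularBorelMeasures X E ≃ₗ[ℝ] RegularOperators C₀(X, ℝ) E}
    (hI : IsIntegrationMap I) (hle : ∀ μ μ', I μ ≤ I μ' ↔ μ ≤ μ')
    (hL : IsVectorLattice (RegularOperators C₀(X, ℝ) E)) (μ : RegularBorelMeasures X E) :
    regularNorm (I μ) = measureNorm μ := by
  have hQ := hE.isQuasiPerfect
  have hM := hL.of_linearEquiv I hle
  have hmod := I.map_modulus hle hM μ
  have hpos := RegularBorelMeasures.isPositiveRegularBorelMeasure hQ.isDedekindComplete
    hQ.normalSeparating (hM.modulus_nonneg μ)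
  have hlub := hI.isLUB_univ hQ.isDedekindComplete hQ.normalSeparating hpos
  have hIpos : IsPositiveOperator (I (modulus μ)).1 := by
    rw [← hmod]
    exact hL.modulus_nonneg _
  apply le_antisymm
  · refine regularNorm_le hL (hL.le_modulus (I μ)) (hL.neg_le_modulus (I μ)) fun f hf hf1 => ?_
    rw [hmod]
    exact norm_le_norm_of_nonneg_of_le (hIpos f hf) (hlub.1 ⟨f, hf, fun x =>
      (le_abs_self _).trans ((f.abs_apply_le_norm x).trans hf1), rfl⟩)
  · have hbd : ∀ a ∈ {a | ∃ f : C₀(X, ℝ), 0 ≤ f ∧ (∀ x, f x ≤ 1) ∧ a = (I (modulus μ)).1 f},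
        ‖a‖ ≤ regularNorm (I μ) := by
      rintro _ ⟨f, hf0, hf1, rfl⟩
      rw [← hmod]
      exact norm_modulus_apply_le_of_norm_le_one hL _ (f.norm_le_of_forall zero_le_one fun x => by
        rw [abs_of_nonneg (hf0 x)]
        exact hf1 x)
    have hne : {a | ∃ f : C₀(X, ℝ), 0 ≤ f ∧ (∀ x, f x ≤ 1) ∧
        a = (I (modulus μ)).1 f}.Nonempty := ⟨_, 0, le_rfl, fun _ => zero_le_one, rfl⟩
    have hdir : DirectedOn (· ≤ ·) {a | ∃ f : C₀(X, ℝ), 0 ≤ f ∧ (∀ x, f x ≤ 1) ∧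
        a = (I (modulus μ)).1 f} := by
      rintro _ ⟨f, hf0, hf1, rfl⟩ _ ⟨g, hg0, hg1, rfl⟩
      exact ⟨_, ⟨f ⊔ g, hf0.trans le_sup_left, fun x => sup_le (hf1 x) (hg1 x), rfl⟩,
        hIpos.mono le_sup_left, hIpos.mono le_sup_right⟩
    obtain ⟨s, hs, ht⟩ := hE.exists_isLUB_tendsto hne hdir
      (by rintro _ ⟨f, hf0, -, rfl⟩; exact hIpos f hf0)
      (isBounded_iff_forall_norm_le.2 ⟨_, hbd⟩)
    rw [measureNorm, hlub.unique hs]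
    have := hne.to_subtype
    have : IsDirectedOrder {a | ∃ f : C₀(X, ℝ), 0 ≤ f ∧ (∀ x, f x ≤ 1) ∧
        a = (I (modulus μ)).1 f} := ⟨fun a b => by
      obtain ⟨c, hc, h1, h2⟩ := hdir a a.2 b b.2
      exact ⟨⟨c, hc⟩, h1, h2⟩⟩
    exact le_of_tendsto ht.norm (Eventually.of_forall fun a => hbd a a.2)

theorem isBanachLattice_norm [CompleteSpace E] : IsBanachLattice E fun x : E => ‖x‖ where
  isVectorLattice :=
    { add_le_add_right := fun _ _ z h => add_le_add_left h z
      smul_le_smul := fun _ _ _ hr h => smul_le_smul_of_nonneg_left h hr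
      exists_sup := fun _ _ => ⟨_, isLUB_pair⟩
      exists_inf := fun _ _ => ⟨_, isGLB_pair⟩
      archimedean := fun x y hx h => by
        by_contra hne
        have hx' : 0 < ‖x‖ := norm_pos_iff.2 hne
        obtain ⟨n, hn⟩ := exists_nat_gt (‖y‖ / ‖x‖)
        rw [div_lt_iff₀ hx'] at hn
        have h1 := norm_le_norm_of_nonneg_of_le (nsmul_nonneg hx n) (h n)
        rw [← Nat.cast_smul_eq_nsmul ℝ, norm_smul, Real.norm_natCast] at h1
        linarith }
  eq_zero_of_norm _ := norm_eq_zero.1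
  norm_add_le := norm_add_le
  norm_smul := norm_smul
  solid x y h := by
    rw [modulus_eq_abs, modulus_eq_abs] at h
    exact norm_le_norm_of_abs_le_abs h
  complete u hu := by
    obtain ⟨x, hx⟩ := cauchySeq_tendsto_of_complete (u := u)
      (Metric.cauchySeq_iff.2 (by simpa only [dist_eq_norm] using hu))
    exact ⟨x, by simpa only [dist_eq_norm] using tendsto_iff_dist_tendsto_zero.1 hx⟩

/-- These rank one operators depend additively on `x` and, by `regularNorm_eval_smul`, have regular
norm `‖x‖`, so additivity of the regular norm passes to `E`. -/
theorem isPositiveOperator_eval_smul (p : X) {x : E} (hx : 0 ≤ x) :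
    IsPositiveOperator ({ toFun := fun f => f p • x
                          map_add' := fun f g => add_smul (f p) (g p) x
                          map_smul' := fun c f => mul_smul c (f p) x } : C₀(X, ℝ) →ₗ[ℝ] E) :=
  fun _ hf => smul_nonneg (hf p) hx

theorem regularNorm_eval_smul (hL : IsVectorLattice (RegularOperators C₀(X, ℝ) E)) (p : X)
    {x : E} (hx : 0 ≤ x) : regularNorm (isPositiveOperator_eval_smul p hx).regular = ‖x‖ := by
  have h0 : 0 ≤ (isPositiveOperator_eval_smul p hx).regular := isPositiveOperator_eval_smul p hx
  apply le_antisymm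
  · refine regularNorm_le hL le_rfl ((neg_nonpos.2 h0).trans h0) fun f _ hf1 => ?_
    change ‖f p • x‖ ≤ ‖x‖
    rw [norm_smul]
    exact mul_le_of_le_one_left (norm_nonneg x) ((f.abs_apply_le_norm p).trans hf1)
  · obtain ⟨f, hf0, hf1, -, hf2⟩ := ZeroAtInftyContinuousMap.exists_eq_one_of_isCompact
      (isCompact_singleton (x := p)) isOpen_univ (Set.subset_univ _)
    have h := norm_modulus_apply_le_of_norm_le_one hL (isPositiveOperator_eval_smul p hx).regular
      (f.norm_le_of_forall zero_le_one fun y => by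
        rw [abs_of_nonneg (hf0 y)]
        exact hf2 y)
    rw [hL.modulus_of_nonneg h0] at h
    change ‖f p • x‖ ≤ _ at h
    rwa [hf1 p rfl, one_smul] at h

theorem isALSpace_of_regularOperators [CompleteSpace E] [Nonempty X]
    (h : IsALSpace (RegularOperators C₀(X, ℝ) E) regularNorm) :
    IsALSpace E fun x : E => ‖x‖ where
  isBanachLattice := isBanachLattice_norm
  norm_add x y hx hy := by
    have hL := h.isBanachLattice.isVectorLattice
    obtain ⟨p⟩ := ‹Nonempty X›
    have h1 := h.norm_add (isPositiveOperator_eval_smul p hx).regular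
      (isPositiveOperator_eval_smul p hy).regular (isPositiveOperator_eval_smul p hx)
      (isPositiveOperator_eval_smul p hy)
    have e : (isPositiveOperator_eval_smul p hx).regular +
        (isPositiveOperator_eval_smul p hy).regular =
        (isPositiveOperator_eval_smul p (add_nonneg hx hy)).regular :=
      Subtype.ext (LinearMap.ext fun f => (smul_add (f p) x y).symm)
    rwa [e, regularNorm_eval_smul hL p hx, regularNorm_eval_smul hL p hy,
      regularNorm_eval_smul hL p (add_nonneg hx hy)] at h1

/-- The norm of a positive measure is the norm of its value at `X`, which is additive in the
measure. -/
theorem isALSpace_regularBorelMeasures [MeasurableSpace X] [BorelSpace X]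
    (hM : IsBanachLattice (RegularBorelMeasures X E) measureNorm)
    (h : IsALSpace E fun x : E => ‖x‖) : IsALSpace (RegularBorelMeasures X E) measureNorm where
  isBanachLattice := hM
  norm_add μ μ' hμ hμ' := by
    have hV := hM.isVectorLattice
    rw [measureNorm, measureNorm, measureNorm, hV.modulus_of_nonneg hμ, hV.modulus_of_nonneg hμ',
      hV.modulus_of_nonneg (add_nonneg hμ hμ')]
    exact h.norm_add _ _ (hμ _) (hμ' _)

end Isometry

theorem mainTheorem3 (X : Type*) [TopologicalSpace X] [T2Space X] [LocallyCompactSpace X]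
    [Nonempty X] [MeasurableSpace X] [BorelSpace X] :
    (∀ (E : Type*) [AddCommGroup E] [Module ℝ E] [Lattice E] [IsOrderedAddMonoid E]
        [IsOrderedModule ℝ E],
      IsQuasiPerfect E →
        IsVectorLattice (RegularBorelMeasures X E) ∧
        IsVectorLattice (RegularOperators C₀(X, ℝ) E) ∧
        ∃ I : RegularBorelMeasures X E ≃ₗ[ℝ] RegularOperators C₀(X, ℝ) E,
          IsIntegrationMap I ∧ IsVectorLatticeIso I) ∧
    (∀ (E : Type*) [NormedAddCommGroup E] [NormedSpace ℝ E] [CompleteSpace E] [Lattice E]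
        [IsOrderedAddMonoid E] [IsOrderedModule ℝ E] [HasSolidNorm E],
      IsKBSpace E →
        IsBanachLattice (RegularBorelMeasures X E) measureNorm ∧
        IsBanachLattice (RegularOperators C₀(X, ℝ) E) regularNorm ∧
        (∀ T : RegularOperators C₀(X, ℝ) E, Continuous T.1) ∧
        (∃ I : RegularBorelMeasures X E ≃ₗ[ℝ] RegularOperators C₀(X, ℝ) E,
          IsIntegrationMap I ∧ IsVectorLatticeIso I ∧
            ∀ μ, regularNorm (I μ) = measureNorm μ) ∧
        (IsALSpace (RegularBorelMeasures X E) measureNorm ↔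
          IsALSpace E (fun x : E => ‖x‖)) ∧
        (IsALSpace (RegularOperators C₀(X, ℝ) E) regularNorm ↔
          IsALSpace E (fun x : E => ‖x‖))) := by
  constructor
  · intro E _ _ _ _ _ hQ
    have hL := RegularOperators.isVectorLattice (F := C₀(X, ℝ)) hQ.isDedekindComplete
      hQ.normalSeparating
    obtain ⟨I, hI, hle⟩ := exists_integrationMap (X := X) hQ
    exact ⟨hL.of_linearEquiv I hle, hL, I, hI, I.isVectorLatticeIso hle⟩
  · intro E _ _ _ _ _ _ _ hKB
    have hQ := hKB.isQuasiPerfect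
    have hL := RegularOperators.isVectorLattice (F := C₀(X, ℝ)) hQ.isDedekindComplete
      hQ.normalSeparating
    obtain ⟨I, hI, hle⟩ := exists_integrationMap (X := X) hQ
    have hN := hKB.regularNorm_eq_measureNorm hI hle hL
    have hLB := RegularOperators.isBanachLattice hL
    have hMB := hLB.of_linearEquiv I hle hN
    have hLM : IsALSpace (RegularOperators C₀(X, ℝ) E) regularNorm ↔
        IsALSpace (RegularBorelMeasures X E) measureNorm :=
      ⟨fun h => h.of_linearEquiv I hle hN, fun h => h.of_linearEquiv I.symm
        (fun S T => by rw [← hle, I.apply_symm_apply, I.apply_symm_apply])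
        fun T => by rw [← hN, I.apply_symm_apply]⟩
    -- The descent to `E` goes through operators, where the rank one operators are available; the
    -- ascent goes through measures.
    have hEM : IsALSpace (RegularBorelMeasures X E) measureNorm ↔
        IsALSpace E (fun x : E => ‖x‖) :=
      ⟨fun h => isALSpace_of_regularOperators (hLM.2 h), isALSpace_regularBorelMeasures hMB⟩
    exact ⟨hMB, hLB, RegularOperators.continuous, ⟨I, hI, I.isVectorLatticeIso hle, hN⟩, hEM,
      hLM.trans hEM⟩
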